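/- **Conventions.** Let $\mathcal L$ be a countable first-order language; structures may be empty. $\mathcal L_{\omega_1\omega}$ formulas $\varphi(x_0,\dots,x_{n-1})$ have finitely many free variables and are built using $\top,\wedge,\exists,\neg$ and countable (possibly empty) disjunctions $\bigvee$. A $\Sigma_1$ formula is built from atomic formulas (including equations, but no negations) using $\top,\wedge,\exists,\bigvee$; for a countable ordinal $\alpha\ge2$, a $\Sigma_\alpha$ formula is built in the same way from $\Sigma_\beta$ formulas and negations of $\Sigma_\beta$ formulas, $1\le\beta<\alpha$. A $\Pi_\alpha$ formula is (up to logical equivalence) the negation of a $\Sigma_\alpha$ formula. In an arbitrary topological space, a $\mathbf\Sigma^0_1$ set is an open set; for $\alpha\ge2$, a $\mathbf\Sigma^0_\alpha$ set is a countable union $\bigcup_i(A_i\setminus B_i)$ where each $A_i$ and each $B_i$ is $\mathbf\Sigma^0_\beta$ for some $1\le\beta<\alpha$; a $\mathbf\Pi^0_\alpha$ set is the complement of a $\mathbf\Sigma^0_\alpha$ set. A space is quasi-Polish if it is homeomorphic to a $\mathbf\Pi^0_2$ subspace of $\mathbb S^{\mathbb N}$, where $\mathbb S=\{0,1\}$ has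 open sets $\emptyset,\{1\},\{0,1\}$. An étale $\mathcal L$-structure $\mathcal M$ over a space $X$ consists of a local homeomorphism $p:M\to X$, a continuous map $f^{\mathcal M}:M^n_X\to M$ over $X$ for each $n$-ary function symbol $f$, and an open set $R^{\mathcal M}\subseteq M^n_X$ for each $n$-ary relation symbol $R$, where $$M^n_X=\{(x,a_0,\dots,a_{n-1})\in X\times M^n : p(a_i)=x \text{ for all } i\}.$$ It is second-countable if $M$ is. Each fiber $M_x=p^{-1}(x)$ then carries an ordinary $\mathcal L$-structure $\mathcal M_x$, and a formula $\varphi(x_0,\dots,x_{n-1})$ defines the set $\varphi^{\mathcal M}=\{(x,\vec a)\in M^n_X:\mathcal M_x\models\varphi(\vec a)\}$. Let $\mathrm{Iso}_X(\mathcal M)$ be the groupoid of all triples $(x,y,g)$ with $x,y\in X$ and $g:\mathcal M_x\cong\mathcal M_y$ an isomorphism; it acts on each $M^n_X$, and in particular on $M^0_X=X$, where $\mathrm{Iso}_X(\mathcal M)\cdot x=\{y\in X:\mathcal M_x\cong\mathcal M_y\}$. One says that $\mathcal M$ has $\Sigma_1$ saturations if for every $n\in\mathbb N$ and every open $U\subseteq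 M^n_X$, the saturation $\mathrm{Iso}_X(\mathcal M)\cdot U$ equals $\varphi^{\mathcal M}$ for some $\Sigma_1$ formula $\varphi$. **Theorem (characterization of Scott rank).** Let $p:\mathcal M\to X$ be a second-countable étale $\mathcal L$-structure with $\Sigma_1$ saturations over a quasi-Polish space $X$, let $x\in X$, and let $1\le\alpha<\omega_1$. The following are equivalent: 1. For every $n$, every orbit of $\mathrm{Aut}(\mathcal M_x)$ on $M_x^n$ is defined in $\mathcal M_x$ by a $\Sigma_\alpha$ formula without parameters. 2. $\mathcal M_x$ has a $\Pi_{\alpha+1}$ Scott sentence: there is a $\Pi_{\alpha+1}$ sentence $\varphi$ such that a countable $\mathcal L$-structure satisfies $\varphi$ if and only if it is isomorphic to $\mathcal M_x$. 3. $\mathrm{Iso}_X(\mathcal M)\cdot x\subseteq X$ is $\mathbf\Pi^0_{\alpha+1}$. 4. For every $n$ and every $\Pi_\alpha$ formula $\psi(z_0,\dots,z_{n-1})$ with $\psi^{\mathcal M_x}\ne\emptyset$, there is a $\Sigma_\alpha$ formula $\theta(z_0,\dots,z_{n-1})$ with $\emptyset\ne\theta^{\mathcal M_x}\subseteq\psi^{\mathcal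 M_x}$. -/

import Mathlib

open FirstOrder

universe u v w z

namespace ScottRank

/-! ### The non-Hausdorff Borel hierarchy and quasi-Polish spaces -/

/-- `BorelSigma α A`: the set `A` is in the class `Σ⁰_α` (for ordinals `α ≥ 1`) of the Borel
hierarchy of an arbitrary, possibly non-metrizable, topological space: `Σ⁰_1` sets are the open
sets, and for `α ≥ 2` the `Σ⁰_α` sets are the countable unions of differences `A i \ B i` where
each `A i` and each `B i` is `Σ⁰_β` for some `1 ≤ β < α`. -/
inductive BorelSigma {X : Type z} [TopologicalSpace X] : Ordinal.{0} → Set X → Prop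
  | of_isOpen {U : Set X} : IsOpen U → BorelSigma 1 U
  | iUnion_diff {α : Ordinal.{0}} (A B : ℕ → Set X) (β γ : ℕ → Ordinal.{0}) :
      2 ≤ α → (∀ i, β i < α) → (∀ i, γ i < α) →
      (∀ i, BorelSigma (β i) (A i)) → (∀ i, BorelSigma (γ i) (B i)) →
      BorelSigma α (⋃ i, A i \ B i)

/-- `Π⁰_α` sets are the complements of `Σ⁰_α` sets. -/
def BorelPi {X : Type z} [TopologicalSpace X] (α : Ordinal.{0}) (A : Set X) : Prop :=
  BorelSigma α Aᶜ

/-- A quasi-Polish space: a space homeomorphic to a `Π⁰_2` subspace of a countable power of the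
Sierpinski space (which is `Prop` with its topology in Mathlib). -/
class QuasiPolishSpace (X : Type z) [TopologicalSpace X] : Prop where
  exists_homeomorph : ∃ S : Set (ℕ → Prop), BorelPi 2 S ∧ Nonempty (X ≃ₜ S)

/-! ### Countably infinitary formulas -/

/-- `L_{ω₁ω}` formulas with free variables among `x_0, …, x_{n-1}`, built from atomic formulas by
`⊤`, `∧`, `∃`, countable disjunctions and `¬`. A countable disjunction is either empty (`bot`)
or, allowing repetitions, indexed by `ℕ` (`iSup`); countable conjunctions and universal
quantifiers are the abbreviations `¬ ⋁ ¬` and `¬ ∃ ¬`. -/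
inductive Formula (L : FirstOrder.Language.{u, v}) : ℕ → Type (max u v)
  | rel {n k : ℕ} (R : L.Relations k) (ts : Fin k → L.Term (Fin n)) : Formula L n
  | equal {n : ℕ} (s t : L.Term (Fin n)) : Formula L n
  | top {n : ℕ} : Formula L n
  | bot {n : ℕ} : Formula L n
  | and {n : ℕ} (φ ψ : Formula L n) : Formula L n
  | iSup {n : ℕ} (φ : ℕ → Formula L n) : Formula L n
  | ex {n : ℕ} (φ : Formula L (n + 1)) : Formula L n
  | neg {n : ℕ} (φ : Formula L n) : Formula L n

namespace Formula

variable {L : FirstOrder.Language.{u, v}}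

/-- Satisfaction of a formula in an ordinary (possibly empty) structure. -/
def Realize {M : Type w} [L.Structure M] : {n : ℕ} → Formula L n → (Fin n → M) → Prop
  | _, rel R ts, a => FirstOrder.Language.Structure.RelMap R (fun i => (ts i).realize a)
  | _, equal s t, a => s.realize a = t.realize a
  | _, top, _ => True
  | _, bot, _ => False
  | _, and φ ψ, a => φ.Realize a ∧ ψ.Realize a
  | _, iSup φ, a => ∃ i, (φ i).Realize a
  | _, ex φ, a => ∃ b : M, φ.Realize (Fin.snoc a b : Fin _ → M)
  | _, neg φ, a => ¬ φ.Realize a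

/-- `Σ_α` formulas, for `α ≥ 1` (there are none for `α = 0`): `Σ_1` formulas are built from atomic
formulas using `⊤`, `∧`, `∃` and countable disjunctions; for `α ≥ 2`, `Σ_α` formulas are built by
the same operations from `Σ_β` formulas and negations of `Σ_β` formulas, for `1 ≤ β < α`. -/
inductive IsSigma : Ordinal.{0} → {n : ℕ} → Formula L n → Prop
  | rel {α : Ordinal.{0}} {n k : ℕ} (hα : 1 ≤ α) (R : L.Relations k)
      (ts : Fin k → L.Term (Fin n)) : IsSigma α (.rel R ts)
  | equal {α : Ordinal.{0}} {n : ℕ} (hα : 1 ≤ α) (s t : L.Term (Fin n)) : IsSigma α (.equal s t)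
  | top {α : Ordinal.{0}} {n : ℕ} (hα : 1 ≤ α) : IsSigma α (.top : Formula L n)
  | bot {α : Ordinal.{0}} {n : ℕ} (hα : 1 ≤ α) : IsSigma α (.bot : Formula L n)
  | and {α : Ordinal.{0}} {n : ℕ} {φ ψ : Formula L n} :
      IsSigma α φ → IsSigma α ψ → IsSigma α (.and φ ψ)
  | iSup {α : Ordinal.{0}} {n : ℕ} {φ : ℕ → Formula L n} :
      (∀ i, IsSigma α (φ i)) → IsSigma α (.iSup φ)
  | ex {α : Ordinal.{0}} {n : ℕ} {φ : Formula L (n + 1)} : IsSigma α φ → IsSigma α (.ex φ)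
  | of_lt {α β : Ordinal.{0}} {n : ℕ} {φ : Formula L n} :
      β < α → IsSigma β φ → IsSigma α φ
  | neg_of_lt {α β : Ordinal.{0}} {n : ℕ} {φ : Formula L n} :
      β < α → IsSigma β φ → IsSigma α (.neg φ)

/-- `Π_α` formulas are (up to logical equivalence) the negations of `Σ_α` formulas. -/
def IsPi (α : Ordinal.{0}) {n : ℕ} (φ : Formula L n) : Prop :=
  ∃ ψ : Formula L n, IsSigma α ψ ∧ φ = .neg ψ

/-- `φ` is a Scott sentence of `M`: its countable models are exactly the countable structures
isomorphic to `M`. -/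
def IsScottSentence (M : Type w) [L.Structure M] (φ : Formula L 0) : Prop :=
  ∀ (N : Type w) [Countable N] [L.Structure N],
    φ.Realize (Fin.elim0 : Fin 0 → N) ↔ Nonempty (M ≃[L] N)

end Formula

/-! ### Étale structures -/

section Etale

variable {X : Type z} [TopologicalSpace X] {M : Type w} [TopologicalSpace M]

/-- The `n`-fold fiber power `M^n_X` of `p : M → X`, recording the base point (so that
`M^0_X = X`), with the subspace topology from `X × M^n`. -/
abbrev FiberPower (p : M → X) (n : ℕ) : Type (max z w) :=
  {q : X × (Fin n → M) // ∀ i, p (q.2 i) = q.1}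

/-- An étale `L`-structure over `X` with underlying space `p : M → X`: the projection `p` is a
local homeomorphism, function symbols are interpreted by continuous maps `M^n_X → M` over `X`, and
relation symbols by open subsets of `M^n_X`. -/
structure EtaleStructure (L : FirstOrder.Language.{u, v}) (p : M → X) where
  isLocalHomeomorph : IsLocalHomeomorph p
  funMap {n : ℕ} (f : L.Functions n) : FiberPower p n → M
  continuous_funMap {n : ℕ} (f : L.Functions n) : Continuous (funMap f)
  proj_funMap {n : ℕ} (f : L.Functions n) (a : FiberPower p n) : p (funMap f a) = a.1.1
  relMap {n : ℕ} (R : L.Relations n) : Set (FiberPower p n)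
  isOpen_relMap {n : ℕ} (R : L.Relations n) : IsOpen (relMap R)

namespace EtaleStructure

variable {L : FirstOrder.Language.{u, v}} {p : M → X}

/-- The fiber of an étale structure over the point `x`. -/
def Fiber (_E : EtaleStructure L p) (x : X) : Type w := {a : M // p a = x}

/-- A tuple in the fiber over `x`, as a point of `M^n_X`. -/
def toPower (E : EtaleStructure L p) {x : X} {n : ℕ} (a : Fin n → E.Fiber x) : FiberPower p n :=
  ⟨(x, fun i => (a i).1), fun i => (a i).2⟩

/-- A point of `M^n_X`, as a tuple in the fiber over its base point. -/
def toTuple (E : EtaleStructure L p) {n : ℕ} (a : FiberPower p n) : Fin n → E.Fiber a.1.1 :=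
  fun i => ⟨a.1.2 i, a.2 i⟩

/-- The fibers are ordinary `L`-structures. -/
instance fiberStructure (E : EtaleStructure L p) (x : X) : L.Structure (E.Fiber x) where
  funMap f a := ⟨E.funMap f (E.toPower a), E.proj_funMap f (E.toPower a)⟩
  RelMap R a := E.toPower a ∈ E.relMap R

/-- The subset of `M^n_X` defined by a formula. -/
def interp (E : EtaleStructure L p) {n : ℕ} (φ : Formula L n) : Set (FiberPower p n) :=
  {a | φ.Realize (E.toTuple a)}

/-- The saturation of `U ⊆ M^n_X` under the isomorphism groupoid: all images of tuples in `U`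
under isomorphisms between fibers. -/
def saturation (E : EtaleStructure L p) {n : ℕ} (U : Set (FiberPower p n)) :
    Set (FiberPower p n) :=
  {b | ∃ a ∈ U, ∃ g : E.Fiber a.1.1 ≃[L] E.Fiber b.1.1, ∀ i, g (E.toTuple a i) = E.toTuple b i}

/-- The orbit of a point `x` of the base under the isomorphism groupoid. -/
def orbit (E : EtaleStructure L p) (x : X) : Set X :=
  {y | Nonempty (E.Fiber x ≃[L] E.Fiber y)}

/-- The saturation of every open subset of every fiber power is defined by a `Σ_1` formula. -/
def HasSigmaOneSaturations (E : EtaleStructure L p) : Prop :=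
  ∀ (n : ℕ) (U : Set (FiberPower p n)), IsOpen U →
    ∃ φ : Formula L n, φ.IsSigma 1 ∧ E.saturation U = E.interp φ

end EtaleStructure

end Etale

end ScottRank

/-! The implications form a cycle 1 → 2 → 3 → 4 → 1, and the weight lies in 3 → 4.

Three of them are comparatively direct. For 1 → 2 (`exists_scottSentence`), given Σ_α definitions of
the orbits, a Π_{α+1} sentence can say that these definitions form a back-and-forth system. For 2 →
3 (`EtaleStructure.borelPi_orbit`), formulas define Borel sets of the same class, because an
existential quantifier is an image under a countable-to-one open map. For 4 → 1
(`exists_isSigma_orbit`), countability of the fiber yields one Π_α formula controlling the Σ_α type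
of a tuple; hypothesis 4 shrinks it to a Σ_α formula isolating that type, and these formulas form a
back-and-forth system.

For 3 → 4, the first half turns topology into logic. Vaught transforms, a category quantifier over
isomorphisms between fibers, replace a Σ⁰_β set by Σ_β definable sets; the base case is the
hypothesis on saturations. Hence `EtaleStructure.exists_isSigmaSet_of_borelPi`: an invariant
Π⁰_{α+1} set is given by countably many implications between Σ_α formulas. The category argument
needs a Baire theorem for the isomorphisms out of one fiber, `EtaleStructure.IsComeager.exists_mem`.

The second half, `EtaleStructure.exists_isSigma_of_borelPi_orbit`, omits a type. If the Π_α formula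
¬σ is realized in M_x but contains no nonempty Σ_α set, a point z is built that is generic for Σ_α
conditions meeting the orbit. It satisfies the implications, hence lies in the orbit, and yet every
tuple over z satisfies σ, a contradiction.

Both constructions of points rest on `exists_generic_point`. A decreasing sequence of sets meets
countably many requirements, and the Π⁰_2 description of a quasi-Polish space makes it converge. The
sets are only required to meet an auxiliary set `K`; the limit need not belong to `K`. -/

namespace ScottRank

open Topology TopologicalSpace

/-! ### The Borel hierarchy -/

section Borel

variable {X : Type z} [TopologicalSpace X]

namespace BorelSigma

theorem one_le {α : Ordinal.{0}} {A : Set X} (h : BorelSigma α A) : 1 ≤ α := by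
  cases h with
  | of_isOpen _ => exact le_rfl
  | iUnion_diff A B β γ h2 => exact le_trans (by norm_num) h2

theorem isOpen {A : Set X} {α : Ordinal.{0}} (h : BorelSigma α A) (hα : α < 2) : IsOpen A := by
  cases h with
  | of_isOpen h => exact h
  | iUnion_diff A B β γ h2 => exact absurd hα (not_lt.2 h2)

theorem two_le_of_lt {α β : Ordinal.{0}} (h1 : 1 ≤ β) (h : β < α) : 2 ≤ α := by
  rw [← one_add_one_eq_two]
  exact Order.add_one_le_of_lt (h1.trans_lt h)

theorem eq_one_or_two_le {α : Ordinal.{0}} (h1 : 1 ≤ α) : α = 1 ∨ 2 ≤ α := by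
  rcases h1.eq_or_lt with h | h
  · exact Or.inl h.symm
  · exact Or.inr (two_le_of_lt le_rfl h)

theorem mono {α β : Ordinal.{0}} {A : Set X} (h : BorelSigma β A) (hβ : β ≤ α) :
    BorelSigma α A := by
  rcases hβ.eq_or_lt with rfl | hlt
  · exact h
  have h2 := two_le_of_lt h.one_le hlt
  have := iUnion_diff (X := X) (α := α) (fun _ => A) (fun _ => ∅) (fun _ => β) (fun _ => 1) h2
    (fun _ => hlt) (fun _ => lt_of_lt_of_le (by norm_num) h2) (fun _ => h)
    (fun _ => of_isOpen isOpen_empty)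
  rwa [Set.iUnion_const, Set.sdiff_empty] at this

theorem exists_eq_iUnion {α : Ordinal.{0}} {A : Set X} (h : BorelSigma α A) (h2 : 2 ≤ α) :
    ∃ (B C : ℕ → Set X) (β γ : ℕ → Ordinal.{0}), (∀ i, β i < α) ∧ (∀ i, γ i < α) ∧
      (∀ i, BorelSigma (β i) (B i)) ∧ (∀ i, BorelSigma (γ i) (C i)) ∧ A = ⋃ i, B i \ C i := by
  cases h with
  | of_isOpen _ => exact absurd h2 (by norm_num)
  | iUnion_diff A B β γ _ h3 h4 h5 h6 => exact ⟨A, B, β, γ, h3, h4, h5, h6, rfl⟩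

theorem iUnion {α : Ordinal.{0}} {A : ℕ → Set X} (h : ∀ i, BorelSigma α (A i)) :
    BorelSigma α (⋃ i, A i) := by
  rcases eq_one_or_two_le (h 0).one_le with rfl | h2
  · exact of_isOpen (isOpen_iUnion fun i => (h i).isOpen (by norm_num))
  choose B C β γ hβ hγ hB hC hA using fun i => (h i).exists_eq_iUnion h2
  have := iUnion_diff (X := X) (α := α) (fun k => B k.unpair.1 k.unpair.2)
    (fun k => C k.unpair.1 k.unpair.2) (fun k => β k.unpair.1 k.unpair.2)
    (fun k => γ k.unpair.1 k.unpair.2) h2 (fun _ => hβ _ _) (fun _ => hγ _ _) (fun _ => hB _ _)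
    (fun _ => hC _ _)
  convert this using 1
  ext x
  simp only [Set.mem_iUnion, hA]
  constructor
  · rintro ⟨i, j, hx⟩
    exact ⟨Nat.pair i j, by simpa using hx⟩
  · rintro ⟨k, hx⟩
    exact ⟨_, _, hx⟩

theorem union {α : Ordinal.{0}} {A B : Set X} (hA : BorelSigma α A) (hB : BorelSigma α B) :
    BorelSigma α (A ∪ B) := by
  have : A ∪ B = ⋃ i : ℕ, if i = 0 then A else B := by
    ext x
    simp only [Set.mem_union, Set.mem_iUnion]
    constructor
    · rintro (h | h)
      · exact ⟨0, by simpa using h⟩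
      · exact ⟨1, by simpa using h⟩
    · rintro ⟨i, h⟩
      split_ifs at h
      · exact Or.inl h
      · exact Or.inr h
  rw [this]
  refine iUnion fun i => ?_
  split_ifs
  · exact hA
  · exact hB

/-- For `α ≥ 2`, a `Σ⁰_α` set is a countable union of differences of an open set and a set of
lower class. -/
theorem exists_eq_iUnion_isOpen {α : Ordinal.{0}} {A : Set X} (h : BorelSigma α A) (h2 : 2 ≤ α) :
    ∃ (O C : ℕ → Set X) (γ : ℕ → Ordinal.{0}), (∀ i, IsOpen (O i)) ∧ (∀ i, γ i < α) ∧
      (∀ i, BorelSigma (γ i) (C i)) ∧ A = ⋃ i, O i \ C i := by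
  induction h with
  | of_isOpen _ => exact absurd h2 (by norm_num)
  | @iUnion_diff α A B β γ _ hβ hγ hA hB ihA _ =>
    have key : ∀ i, ∃ (O C : ℕ → Set X) (δ : ℕ → Ordinal.{0}), (∀ j, IsOpen (O j)) ∧
        (∀ j, δ j < α) ∧ (∀ j, BorelSigma (δ j) (C j)) ∧ A i \ B i = ⋃ j, O j \ C j := by
      intro i
      rcases eq_one_or_two_le (hA i).one_le with h1 | h1
      · refine ⟨fun _ => A i, fun _ => B i, fun _ => γ i,
          fun _ => (hA i).isOpen (by rw [h1]; norm_num), fun _ => hγ i, fun _ => hB i, ?_⟩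
        rw [Set.iUnion_const]
      · obtain ⟨O, C, δ, hO, hδ, hC, e⟩ := ihA i h1
        refine ⟨O, fun j => C j ∪ B i, fun j => max (δ j) (γ i), hO,
          fun j => max_lt ((hδ j).trans (hβ i)) (hγ i),
          fun j => ((hC j).mono (le_max_left _ _)).union ((hB i).mono (le_max_right _ _)), ?_⟩
        rw [e]
        ext x
        simp only [Set.mem_sdiff, Set.mem_iUnion, Set.mem_union, not_or, ← and_assoc,
          exists_and_right]
    choose O C δ hO hδ hC e using key
    refine ⟨fun k => O k.unpair.1 k.unpair.2, fun k => C k.unpair.1 k.unpair.2,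
      fun k => δ k.unpair.1 k.unpair.2, fun _ => hO _ _, fun _ => hδ _ _, fun _ => hC _ _, ?_⟩
    ext x
    simp only [e, Set.mem_iUnion]
    constructor
    · rintro ⟨i, j, hx⟩
      exact ⟨Nat.pair i j, by simpa using hx⟩
    · rintro ⟨k, hx⟩
      exact ⟨_, _, hx⟩

theorem inter {α : Ordinal.{0}} {A B : Set X} (hA : BorelSigma α A) (hB : BorelSigma α B) :
    BorelSigma α (A ∩ B) := by
  rcases eq_one_or_two_le hA.one_le with rfl | h2
  · exact of_isOpen ((hA.isOpen (by norm_num)).inter (hB.isOpen (by norm_num)))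
  obtain ⟨O, C, γ, hO, hγ, hC, rfl⟩ := hA.exists_eq_iUnion_isOpen h2
  obtain ⟨O', C', γ', hO', hγ', hC', rfl⟩ := hB.exists_eq_iUnion_isOpen h2
  have := iUnion_diff (X := X) (α := α) (fun k => O k.unpair.1 ∩ O' k.unpair.2)
    (fun k => C k.unpair.1 ∪ C' k.unpair.2) (fun _ => 1)
    (fun k => max (γ k.unpair.1) (γ' k.unpair.2)) h2
    (fun _ => lt_of_lt_of_le (by norm_num) h2) (fun _ => max_lt (hγ _) (hγ' _))
    (fun _ => of_isOpen ((hO _).inter (hO' _)))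
    (fun _ => ((hC _).mono (le_max_left _ _)).union ((hC' _).mono (le_max_right _ _)))
  convert this using 1
  ext x
  simp only [Set.mem_inter_iff, Set.mem_iUnion, Set.mem_sdiff, Set.mem_union]
  constructor
  · rintro ⟨⟨i, h1, h2⟩, ⟨j, h3, h4⟩⟩
    exact ⟨Nat.pair i j, by simp_all⟩
  · rintro ⟨k, h1, h2⟩
    exact ⟨⟨k.unpair.1, by tauto⟩, ⟨k.unpair.2, by tauto⟩⟩

theorem compl_of_lt {α β : Ordinal.{0}} {A : Set X} (h : BorelSigma β A) (hβ : β < α) :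
    BorelSigma α Aᶜ := by
  have h2 := two_le_of_lt h.one_le hβ
  have := iUnion_diff (X := X) (α := α) (fun _ => Set.univ) (fun _ => A) (fun _ => 1) (fun _ => β)
    h2 (fun _ => lt_of_lt_of_le (by norm_num) h2) (fun _ => hβ)
    (fun _ => of_isOpen isOpen_univ) (fun _ => h)
  rw [Set.iUnion_const] at this
  rwa [Set.compl_eq_univ_sdiff]

theorem preimage {Y : Type w} [TopologicalSpace Y] {f : Y → X} (hf : Continuous f)
    {α : Ordinal.{0}} {A : Set X} (h : BorelSigma α A) : BorelSigma α (f ⁻¹' A) := by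
  induction h with
  | of_isOpen h => exact of_isOpen (h.preimage hf)
  | iUnion_diff A B β γ h2 hβ hγ _ _ ihA ihB =>
    rw [Set.preimage_iUnion]
    exact iUnion_diff _ _ β γ h2 hβ hγ ihA ihB

/-- Images under an injective map commute with differences. Applied on countably many sheets, this
shows that existential quantification does not raise the Borel class. -/
theorem image_inter_of_injOn {Y : Type w} [TopologicalSpace Y] {f : X → Y} (hf : IsOpenMap f)
    {W : Set X} (hW : IsOpen W) (hi : Set.InjOn f W)
    {α : Ordinal.{0}} {A : Set X} (h : BorelSigma α A) : BorelSigma α (f '' (A ∩ W)) := by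
  induction h with
  | of_isOpen h => exact of_isOpen (hf _ (h.inter hW))
  | iUnion_diff A B β γ h2 hβ hγ _ _ ihA ihB =>
    convert iUnion_diff _ _ β γ h2 hβ hγ ihA ihB using 1
    ext y
    simp only [Set.mem_image, Set.mem_inter_iff, Set.mem_iUnion, Set.mem_sdiff]
    constructor
    · rintro ⟨x, ⟨⟨i, hA, hB⟩, hx⟩, rfl⟩
      refine ⟨i, ⟨x, ⟨hA, hx⟩, rfl⟩, ?_⟩
      rintro ⟨x', ⟨hB', hx'⟩, e⟩
      exact hB (hi hx' hx e ▸ hB')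
    · rintro ⟨i, ⟨x, ⟨hA, hx⟩, rfl⟩, hn⟩
      exact ⟨x, ⟨⟨i, hA, fun hB => hn ⟨x, ⟨hB, hx⟩, rfl⟩⟩, hx⟩, rfl⟩

end BorelSigma

end Borel

/-! ### Quasi-Polish spaces -/

section QuasiPolish

variable (X : Type z) [TopologicalSpace X]

theorem QuasiPolishSpace.exists_isEmbedding [QuasiPolishSpace X] :
    ∃ e : X → ℕ → Prop, IsEmbedding e ∧ BorelPi 2 (Set.range e) := by
  obtain ⟨S, hS, ⟨h⟩⟩ := QuasiPolishSpace.exists_homeomorph (X := X)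
  refine ⟨Subtype.val ∘ h, IsEmbedding.subtypeVal.comp h.isEmbedding, ?_⟩
  rwa [Set.range_comp, h.surjective.range_eq, Set.image_univ, Subtype.range_coe]

variable {X}

theorem QuasiPolishSpace.of_isEmbedding {e : X → ℕ → Prop} (he : IsEmbedding e)
    (h : BorelPi 2 (Set.range e)) : QuasiPolishSpace X :=
  ⟨⟨_, h, ⟨he.toHomeomorph⟩⟩⟩

variable (X)

theorem QuasiPolishSpace.secondCountableTopology [QuasiPolishSpace X] :
    SecondCountableTopology X := by
  obtain ⟨e, he, _⟩ := QuasiPolishSpace.exists_isEmbedding X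
  have : SecondCountableTopology Prop := Finite.toSecondCountableTopology
  exact he.secondCountableTopology

/-- Isomorphisms between fibers will be coded by points of this product. -/
instance QuasiPolishSpace.prod_pi [QuasiPolishSpace X] : QuasiPolishSpace (X × (ℕ → Prop)) := by
  obtain ⟨e, he, hr⟩ := QuasiPolishSpace.exists_isEmbedding X
  let k : (ℕ → Prop) ≃ₜ (ℕ → Prop) × (ℕ → Prop) :=
    (Homeomorph.piCongrLeft (Y := fun _ => Prop) Equiv.natSumNatEquivNat).symm.trans
      Homeomorph.sumArrowHomeomorphProdArrow
  have hf : IsEmbedding (k.symm ∘ Prod.map e id : X × (ℕ → Prop) → ℕ → Prop) :=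
    k.symm.isEmbedding.comp (he.prodMap IsEmbedding.id)
  refine QuasiPolishSpace.of_isEmbedding hf ?_
  have : Set.range (k.symm ∘ Prod.map e id : X × (ℕ → Prop) → ℕ → Prop)
      = (Prod.fst ∘ k) ⁻¹' Set.range e := by
    ext c
    constructor
    · rintro ⟨⟨x, d⟩, rfl⟩
      simp
    · rintro ⟨x, hx⟩
      refine ⟨(x, (k c).2), ?_⟩
      simp only [Function.comp_apply, Prod.map_apply, id] at hx ⊢
      rw [hx]
      simp
  rw [this, BorelPi, ← Set.preimage_compl]
  exact BorelSigma.preimage (continuous_fst.comp k.continuous) hr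

/-- The basic open subset of `S^ℕ` given by a finite set of coordinates. -/
def cylinder (s : Finset ℕ) : Set (ℕ → Prop) := {c | ∀ j ∈ s, c j}

theorem isOpen_cylinder (s : Finset ℕ) : IsOpen (cylinder s) := by
  have : cylinder s = ⋂ j ∈ s, (fun c : ℕ → Prop => c j) ⁻¹' {True} := by
    ext c
    simp [cylinder]
  rw [this]
  exact isOpen_biInter_finset fun j _ => isOpen_singleton_true.preimage (continuous_apply j)

/-- Positive coordinates suffice, since the only neighbourhood of `False` in the Sierpinski space is
the whole space. -/
theorem exists_cylinder_subset {O : Set (ℕ → Prop)} (hO : IsOpen O) {c : ℕ → Prop} (hc : c ∈ O) :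
    ∃ s, c ∈ cylinder s ∧ cylinder s ⊆ O := by
  classical
  obtain ⟨I, u, hu, hI⟩ := isOpen_pi_iff.1 hO c hc
  refine ⟨I.filter c, fun j hj => (Finset.mem_filter.1 hj).2, fun d hd => hI fun i hi => ?_⟩
  by_cases hci : c i
  · have hdi : d i := hd i (Finset.mem_filter.2 ⟨hi, hci⟩)
    have : d i = c i := propext ⟨fun _ => hci, fun _ => hdi⟩
    rw [this]
    exact (hu i hi).2
  · have h1 : u i ∈ 𝓝 (c i) := (hu i hi).1.mem_nhds (hu i hi).2
    rw [eq_false hci, nhds_false, Filter.mem_top] at h1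
    rw [h1]
    trivial

end QuasiPolish

/-! ### Generic points

A decreasing sequence of sets, from a class `𝒮` and meeting a set `K`, is made to meet countably
many requirements; in a quasi-Polish space it can be made to converge to a point. -/

section Generic

variable {X : Type z}

/-- A requirement `T` asks that a sequence which enters `T.1` later enters a member of `T.2`. It is
feasible if this can always be achieved by intersecting with a member of `T.2`. -/
def Feasible (𝒮 : Set (Set X)) (K : Set X) (T : Set X × Set (Set X)) : Prop :=
  (∀ B ∈ T.2, B ∈ 𝒮) ∧
    ∀ S ∈ 𝒮, S ⊆ T.1 → (S ∩ K).Nonempty → ∃ B ∈ T.2, (S ∩ B ∩ K).Nonempty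

/-- A decreasing sequence of nonempty sets meeting all requirements in `𝒯`. -/
structure IsRun (𝒯 : Set (Set X × Set (Set X))) (S : ℕ → Set X) : Prop where
  antitone : Antitone S
  nonempty (k : ℕ) : (S k).Nonempty
  meets : ∀ T ∈ 𝒯, ∀ k, S k ⊆ T.1 → ∃ l, ∃ B ∈ T.2, S l ⊆ B

theorem IsRun.subset {𝒯 𝒯' : Set (Set X × Set (Set X))} {S : ℕ → Set X} (h : IsRun 𝒯 S)
    (h' : 𝒯' ⊆ 𝒯) : IsRun 𝒯' S :=
  ⟨h.antitone, h.nonempty, fun T hT => h.meets T (h' hT)⟩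

/-- A Rasiowa–Sikorski argument in which the conditions are the members of `𝒮` meeting `K`. -/
theorem exists_isRun {𝒮 : Set (Set X)} {K : Set X}
    (hinter : ∀ A ∈ 𝒮, ∀ B ∈ 𝒮, A ∩ B ∈ 𝒮) {𝒯 : Set (Set X × Set (Set X))}
    (hc : 𝒯.Countable) (hf : ∀ T ∈ 𝒯, Feasible 𝒮 K T) {S₀ : Set X} (h₀ : S₀ ∈ 𝒮)
    (hK : (S₀ ∩ K).Nonempty) : ∃ S : ℕ → Set X, S 0 = S₀ ∧ IsRun 𝒯 S := by
  classical
  rcases 𝒯.eq_empty_or_nonempty with rfl | hne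
  · exact ⟨fun _ => S₀, rfl, fun _ _ _ => le_rfl, fun _ => hK.mono Set.inter_subset_left,
      fun T hT => absurd hT (Set.notMem_empty T)⟩
  obtain ⟨t, rfl⟩ := hc.exists_eq_range hne
  have step : ∀ (i : ℕ) (S : {S : Set X // S ∈ 𝒮 ∧ (S ∩ K).Nonempty}),
      ∃ S' : {S : Set X // S ∈ 𝒮 ∧ (S ∩ K).Nonempty}, S'.1 ⊆ S.1 ∧
        (S.1 ⊆ (t i).1 → ∃ B ∈ (t i).2, S'.1 ⊆ B) := by
    rintro i ⟨S, hS, hSK⟩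
    by_cases h : S ⊆ (t i).1
    · obtain ⟨B, hB, hB'⟩ := (hf (t i) ⟨i, rfl⟩).2 S hS h hSK
      exact ⟨⟨S ∩ B, hinter _ hS _ ((hf (t i) ⟨i, rfl⟩).1 B hB), hB'⟩, Set.inter_subset_left,
        fun _ => ⟨B, hB, Set.inter_subset_right⟩⟩
    · exact ⟨⟨S, hS, hSK⟩, le_rfl, fun h' => absurd h' h⟩
  choose next hnext hnext' using step
  let S : ℕ → {S : Set X // S ∈ 𝒮 ∧ (S ∩ K).Nonempty} := fun k =>
    Nat.rec ⟨S₀, h₀, hK⟩ (fun k S => next k.unpair.1 S) k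
  have hanti : Antitone fun k => (S k).1 := antitone_nat_of_succ_le fun k => hnext _ (S k)
  refine ⟨fun k => (S k).1, rfl, hanti, fun k => (S k).2.2.mono Set.inter_subset_left, ?_⟩
  -- Stage m treats requirement `m.unpair.1`, so requirement i is treated at stage `Nat.pair i k`,
  -- which is at least k.
  rintro _ ⟨i, rfl⟩ k hk
  have hik : k ≤ Nat.pair i k := Nat.right_le_pair i k
  have := hnext' (Nat.pair i k).unpair.1 (S (Nat.pair i k))
  obtain ⟨B, hB, hB'⟩ := this (by simpa using (hanti hik).trans hk)
  exact ⟨Nat.pair i k + 1, B, by simpa using hB, hB'⟩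

/-- The sequence `S` converges to `x`, in the coordinates `e`. -/
def ConvergesTo (e : X → ℕ → Prop) (S : ℕ → Set X) (x : X) : Prop :=
  ∀ j, e x j ↔ ∃ k, S k ⊆ {y | e y j}

/-- Countably many feasible requirements ensure that the limit is in `A` exactly if the sequence
enters `A`. -/
def Decided (e : X → ℕ → Prop) (𝒮 : Set (Set X)) (K A : Set X) : Prop :=
  ∃ 𝒯 : Set (Set X × Set (Set X)), 𝒯.Countable ∧ (∀ T ∈ 𝒯, Feasible 𝒮 K T) ∧
    ∀ S x, IsRun 𝒯 S → ConvergesTo e S x → (x ∈ A ↔ ∃ k, S k ⊆ A)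

theorem ConvergesTo.exists_subset_cylinder {e : X → ℕ → Prop} {S : ℕ → Set X} (hS : Antitone S)
    {s : Finset ℕ} (h : ∀ j ∈ s, ∃ k, S k ⊆ {y | e y j}) :
    ∃ k, S k ⊆ e ⁻¹' cylinder s := by
  classical
  induction s using Finset.induction_on with
  | empty => exact ⟨0, fun x _ j hj => absurd hj (Finset.notMem_empty j)⟩
  | insert a s _ ih =>
    obtain ⟨k, hk⟩ := ih fun j hj => h j (Finset.mem_insert_of_mem hj)
    obtain ⟨l, hl⟩ := h a (Finset.mem_insert_self a s)
    refine ⟨max k l, fun x hx j hj => ?_⟩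
    rcases Finset.mem_insert.1 hj with rfl | hj
    · exact hl (hS (le_max_right k l) hx)
    · exact hk (hS (le_max_left k l) hx) j hj

namespace Decided

variable {e : X → ℕ → Prop} {𝒮 : Set (Set X)} {K : Set X}

theorem iUnion {ι : Type*} [Countable ι] {A : ι → Set X} (hA : ∀ i, Decided e 𝒮 K (A i)) (hA' : ∀ i, A i ∈ 𝒮) :
    Decided e 𝒮 K (⋃ i, A i) := by
  choose 𝒯 hc hf h using hA
  refine ⟨insert (⋃ i, A i, Set.range A) (⋃ i, 𝒯 i), (Set.countable_iUnion hc).insert _, ?_, ?_⟩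
  · intro T hT
    rcases hT with rfl | hT
    · refine ⟨by rintro _ ⟨i, rfl⟩; exact hA' i, ?_⟩
      rintro S _ hSA ⟨x, hx, hxK⟩
      obtain ⟨i, hi⟩ := Set.mem_iUnion.1 (hSA hx)
      exact ⟨A i, ⟨i, rfl⟩, x, ⟨hx, hi⟩, hxK⟩
    · obtain ⟨i, hi⟩ := Set.mem_iUnion.1 hT
      exact hf i T hi
  · intro S x hS hx
    have hi : ∀ i, x ∈ A i ↔ ∃ k, S k ⊆ A i := fun i => h i S x
      (hS.subset ((Set.subset_iUnion 𝒯 i).trans (Set.subset_insert _ _))) hx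
    constructor
    · intro hxA
      obtain ⟨i, hxi⟩ := Set.mem_iUnion.1 hxA
      obtain ⟨k, hk⟩ := (hi i).1 hxi
      exact ⟨k, hk.trans (Set.subset_iUnion A i)⟩
    · rintro ⟨k, hk⟩
      obtain ⟨l, _, ⟨i, rfl⟩, hl⟩ := hS.meets _ (Set.mem_insert _ _) k hk
      exact Set.mem_iUnion.2 ⟨i, (hi i).2 ⟨l, hl⟩⟩

theorem inter {A B : Set X} (hA : Decided e 𝒮 K A) (hB : Decided e 𝒮 K B) :
    Decided e 𝒮 K (A ∩ B) := by
  obtain ⟨𝒯, hc, hf, h⟩ := hA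
  obtain ⟨𝒯', hc', hf', h'⟩ := hB
  refine ⟨𝒯 ∪ 𝒯', hc.union hc', fun T hT => hT.elim (hf T) (hf' T), fun S x hS hx => ?_⟩
  rw [Set.mem_inter_iff, h S x (hS.subset Set.subset_union_left) hx,
    h' S x (hS.subset Set.subset_union_right) hx]
  constructor
  · rintro ⟨⟨k, hk⟩, ⟨l, hl⟩⟩
    exact ⟨max k l, Set.subset_inter ((hS.antitone (le_max_left k l)).trans hk)
      ((hS.antitone (le_max_right k l)).trans hl)⟩
  · rintro ⟨k, hk⟩
    exact ⟨⟨k, fun x hx => (hk hx).1⟩, ⟨k, fun x hx => (hk hx).2⟩⟩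

theorem sdiff {A B : Set X} (hA : Decided e 𝒮 K A) (hB : Decided e 𝒮 K B) (hB' : B ∈ 𝒮)
    (hAB : A \ B ∈ 𝒮) : Decided e 𝒮 K (A \ B) := by
  obtain ⟨𝒯, hc, hf, h⟩ := hA
  obtain ⟨𝒯', hc', hf', h'⟩ := hB
  -- The added requirement makes a sequence that has entered A commit itself to B or to its
  -- complement.
  refine ⟨insert (A, {B, A \ B}) (𝒯 ∪ 𝒯'), (hc.union hc').insert _, ?_, fun S x hS hx => ?_⟩
  · intro T hT
    rcases hT with rfl | hT | hT
    · refine ⟨by rintro _ (rfl | rfl) <;> assumption, ?_⟩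
      rintro S _ hSA ⟨x, hx, hxK⟩
      by_cases hxB : x ∈ B
      · exact ⟨B, Or.inl rfl, x, ⟨hx, hxB⟩, hxK⟩
      · exact ⟨A \ B, Or.inr rfl, x, ⟨hx, hSA hx, hxB⟩, hxK⟩
    · exact hf T hT
    · exact hf' T hT
  · have e1 := h S x (hS.subset (Set.subset_union_left.trans (Set.subset_insert _ _))) hx
    have e2 := h' S x (hS.subset (Set.subset_union_right.trans (Set.subset_insert _ _))) hx
    constructor
    · rintro ⟨hxA, hxB⟩
      obtain ⟨k, hk⟩ := e1.1 hxA
      obtain ⟨l, C, (rfl | rfl), hl⟩ := hS.meets _ (Set.mem_insert _ _) k hk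
      · exact absurd (e2.2 ⟨l, hl⟩) hxB
      · exact ⟨l, hl⟩
    · rintro ⟨k, hk⟩
      refine ⟨e1.2 ⟨k, fun x hx => (hk hx).1⟩, fun hxB => ?_⟩
      obtain ⟨l, hl⟩ := e2.1 hxB
      obtain ⟨y, hy⟩ := hS.nonempty (max k l)
      exact (hk (hS.antitone (le_max_left k l) hy)).2 (hl (hS.antitone (le_max_right k l) hy))

theorem of_isOpen [TopologicalSpace X] (he : IsEmbedding e) (h𝒮 : ∀ U : Set X, IsOpen U → U ∈ 𝒮)
    {U : Set X} (hU : IsOpen U) : Decided e 𝒮 K U := by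
  obtain ⟨V, hV, rfl⟩ := he.isOpen_iff.1 hU
  let B : Set (Set X) := {C | ∃ s : Finset ℕ, cylinder s ⊆ V ∧ C = e ⁻¹' cylinder s}
  -- The limit only records coordinates, so a sequence inside an open set must be made to enter a
  -- cylinder contained in it.
  refine ⟨{(e ⁻¹' V, B)}, Set.countable_singleton _, ?_, fun S x hS hx => ?_⟩
  · rintro _ rfl
    refine ⟨?_, ?_⟩
    · rintro _ ⟨s, _, rfl⟩
      exact h𝒮 _ ((isOpen_cylinder s).preimage he.continuous)
    · rintro S _ hSV ⟨x, hx, hxK⟩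
      obtain ⟨s, hs, hsV⟩ := exists_cylinder_subset hV (hSV hx)
      exact ⟨_, ⟨s, hsV, rfl⟩, x, ⟨hx, hs⟩, hxK⟩
  · constructor
    · intro hxV
      obtain ⟨s, hs, hsV⟩ := exists_cylinder_subset hV hxV
      obtain ⟨k, hk⟩ := ConvergesTo.exists_subset_cylinder hS.antitone
        fun j hj => (hx j).1 (hs j hj)
      exact ⟨k, hk.trans (Set.preimage_mono hsV)⟩
    · rintro ⟨k, hk⟩
      obtain ⟨l, _, ⟨s, hsV, rfl⟩, hl⟩ := hS.meets _ rfl k hk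
      exact hsV fun j hj => (hx j).2 ⟨l, fun y hy => hl hy j hj⟩

end Decided

/-- The range of e is given by implications between open sets, "in A i implies in B i". The
coordinates which the sequence enters form a point of S^ℕ, and one requirement for each i and each
cylinder inside A i puts this point in the range. -/
theorem exists_convergesTo [TopologicalSpace X] {e : X → ℕ → Prop} (he : IsEmbedding e)
    (hr : BorelPi 2 (Set.range e)) {𝒮 : Set (Set X)} (h𝒮 : ∀ U : Set X, IsOpen U → U ∈ 𝒮)
    (K : Set X) :
    ∃ 𝒯 : Set (Set X × Set (Set X)), 𝒯.Countable ∧ (∀ T ∈ 𝒯, Feasible 𝒮 K T) ∧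
      ∀ S, IsRun 𝒯 S → ∃ x, ConvergesTo e S x := by
  obtain ⟨A, B, β, γ, hβ, hγ, hA, hB, hAB⟩ := BorelSigma.exists_eq_iUnion hr le_rfl
  have hA' := fun i => (hA i).isOpen (hβ i)
  have hB' := fun i => (hB i).isOpen (hγ i)
  have hmem : ∀ c, c ∈ Set.range e ↔ ∀ i, c ∈ A i → c ∈ B i := by
    intro c
    rw [← not_iff_not, ← Set.mem_compl_iff, hAB]
    simp
  let f : ℕ × Finset ℕ → Set X × Set (Set X) := fun q =>
    (e ⁻¹' cylinder q.2, {C | ∃ s : Finset ℕ, cylinder s ⊆ B q.1 ∧ C = e ⁻¹' cylinder s})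
  refine ⟨f '' {q | cylinder q.2 ⊆ A q.1}, (Set.to_countable _).image _, ?_, ?_⟩
  · rintro _ ⟨⟨i, s⟩, hs, rfl⟩
    refine ⟨?_, ?_⟩
    · rintro _ ⟨t, _, rfl⟩
      exact h𝒮 _ ((isOpen_cylinder t).preimage he.continuous)
    · rintro S _ hSV ⟨x, hx, hxK⟩
      obtain ⟨t, ht, htV⟩ := exists_cylinder_subset (hB' i) ((hmem _).1 ⟨x, rfl⟩ i (hs (hSV hx)))
      exact ⟨_, ⟨t, htV, rfl⟩, x, ⟨hx, ht⟩, hxK⟩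
  · intro S hS
    have : (fun j => ∃ k, S k ⊆ {y | e y j}) ∈ Set.range e := by
      rw [hmem]
      intro i hi
      obtain ⟨s, hs, hsA⟩ := exists_cylinder_subset (hA' i) hi
      obtain ⟨k, hk⟩ := ConvergesTo.exists_subset_cylinder hS.antitone hs
      obtain ⟨l, _, ⟨t, ht, rfl⟩, hl⟩ := hS.meets _ ⟨(i, s), hsA, rfl⟩ k hk
      exact ht fun j hj => ⟨l, fun y hy => hl hy j hj⟩
    obtain ⟨x, hx⟩ := this
    exact ⟨x, fun j => by rw [hx]⟩

/-- Existence of generic points in quasi-Polish spaces. -/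
theorem exists_generic_point [TopologicalSpace X] {e : X → ℕ → Prop} (he : IsEmbedding e)
    (hr : BorelPi 2 (Set.range e)) {𝒮 : Set (Set X)} (h𝒮 : ∀ U : Set X, IsOpen U → U ∈ 𝒮)
    (hinter : ∀ A ∈ 𝒮, ∀ B ∈ 𝒮, A ∩ B ∈ 𝒮) {K : Set X} {ι : Type*} [Countable ι]
    {A B : ι → Set X} (hA : ∀ i, Decided e 𝒮 K (A i)) (hB : ∀ i, Decided e 𝒮 K (B i))
    (hB' : ∀ i, B i ∈ 𝒮)
    (hAB : ∀ i, ∀ S ∈ 𝒮, S ⊆ A i → (S ∩ K).Nonempty → (S ∩ B i ∩ K).Nonempty)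
    {S₀ : Set X} (h₀ : S₀ ∈ 𝒮) (hd : Decided e 𝒮 K S₀) (hK : (S₀ ∩ K).Nonempty) :
    ∃ x ∈ S₀, ∀ i, x ∈ A i → x ∈ B i := by
  obtain ⟨𝒯, hc, hf, h⟩ := exists_convergesTo he hr h𝒮 K
  obtain ⟨𝒯₀, hc₀, hf₀, h₀'⟩ := hd
  choose 𝒯A hcA hfA hA using hA
  choose 𝒯B hcB hfB hB using hB
  let 𝒰 : Set (Set X × Set (Set X)) :=
    𝒯 ∪ 𝒯₀ ∪ (⋃ i, 𝒯A i) ∪ (⋃ i, 𝒯B i) ∪ Set.range fun i => (A i, {B i})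
  obtain ⟨S, hS0, hS⟩ := exists_isRun (𝒯 := 𝒰) hinter
    ((((hc.union hc₀).union (Set.countable_iUnion hcA)).union (Set.countable_iUnion hcB)).union
      (Set.countable_range _)) (by
      rintro T ((((hT | hT) | hT) | hT) | ⟨i, rfl⟩)
      · exact hf T hT
      · exact hf₀ T hT
      · obtain ⟨i, hi⟩ := Set.mem_iUnion.1 hT
        exact hfA i T hi
      · obtain ⟨i, hi⟩ := Set.mem_iUnion.1 hT
        exact hfB i T hi
      · refine ⟨by rintro _ rfl; exact hB' i, fun S hS hSA hSK => ⟨B i, rfl, hAB i S hS hSA hSK⟩⟩)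
    h₀ hK
  obtain ⟨x, hx⟩ := h S (hS.subset fun T hT => Or.inl (Or.inl (Or.inl (Or.inl hT))))
  refine ⟨x, (h₀' S x (hS.subset fun T hT => Or.inl (Or.inl (Or.inl (Or.inr hT)))) hx).2
    ⟨0, hS0.le⟩, fun i hxA => ?_⟩
  obtain ⟨k, hk⟩ := (hA i S x (hS.subset fun T hT => Or.inl (Or.inl (Or.inr
    (Set.mem_iUnion.2 ⟨i, hT⟩)))) hx).1 hxA
  obtain ⟨l, _, rfl, hl⟩ := hS.meets _ (Or.inr ⟨i, rfl⟩) k hk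
  exact (hB i S x (hS.subset fun T hT => Or.inl (Or.inr (Set.mem_iUnion.2 ⟨i, hT⟩))) hx).2 ⟨l, hl⟩

end Generic

/-! ### Operations on formulas -/

namespace Formula

variable {L : FirstOrder.Language.{u, v}}

theorem IsSigma.one_le {α : Ordinal.{0}} {n : ℕ} {φ : Formula L n} (h : φ.IsSigma α) : 1 ≤ α := by
  induction h with
  | rel h | equal h | top h | bot h => exact h
  | and _ _ h _ => exact h
  | iSup _ h => exact h 0
  | ex _ h => exact h
  | of_lt h _ h' | neg_of_lt h _ h' => exact h'.trans h.le

theorem IsSigma.mono {α β : Ordinal.{0}} {n : ℕ} {φ : Formula L n} (h : φ.IsSigma β)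
    (hβ : β ≤ α) : φ.IsSigma α := by
  rcases hβ.eq_or_lt with rfl | hlt
  · exact h
  · exact .of_lt hlt h

/-- Change of variables. -/
def rename : {n m : ℕ} → (Fin n → Fin m) → Formula L n → Formula L m
  | _, _, f, rel R ts => rel R fun i => (ts i).relabel f
  | _, _, f, equal s t => equal (s.relabel f) (t.relabel f)
  | _, _, _, top => top
  | _, _, _, bot => bot
  | _, _, f, and φ ψ => and (φ.rename f) (ψ.rename f)
  | _, _, f, iSup φ => iSup fun i => (φ i).rename f
  | _, _, f, ex φ => ex (φ.rename (Fin.snoc (Fin.castSucc ∘ f) (Fin.last _) : Fin (_ + 1) → _))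
  | _, _, f, neg φ => neg (φ.rename f)

theorem IsSigma.rename {α : Ordinal.{0}} {n m : ℕ} {φ : Formula L n} (h : φ.IsSigma α)
    (f : Fin n → Fin m) : (φ.rename f).IsSigma α := by
  induction h generalizing m with
  | rel h R ts => exact .rel h _ _
  | equal h s t => exact .equal h _ _
  | top h => exact .top h
  | bot h => exact .bot h
  | and _ _ h h' => exact .and (h f) (h' f)
  | iSup _ h => exact .iSup fun i => h i f
  | ex _ h => exact .ex (h _)
  | of_lt h _ h' => exact .of_lt h (h' f)
  | neg_of_lt h _ h' => exact .neg_of_lt h (h' f)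

variable {M : Type w} [L.Structure M] {N : Type w} [L.Structure N]

@[simp]
theorem realize_rename {n m : ℕ} (φ : Formula L n) (f : Fin n → Fin m) (a : Fin m → M) :
    (φ.rename f).Realize a ↔ φ.Realize (a ∘ f) := by
  induction φ generalizing m with
  | rel R ts => simp [rename, Realize]
  | equal s t => simp [rename, Realize]
  | top => rfl
  | bot => rfl
  | and φ ψ h h' => simp [rename, Realize, h, h']
  | iSup φ h => simp [rename, Realize, h]
  | @ex n φ h =>
    simp only [rename, Realize, h]
    refine exists_congr fun b => ?_
    have : (Fin.snoc a b : Fin (m + 1) → M) ∘ (Fin.snoc (Fin.castSucc ∘ f) (Fin.last _) :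
        Fin (n + 1) → Fin (m + 1)) = (Fin.snoc (a ∘ f) b : Fin (n + 1) → M) := by
      funext i
      refine Fin.lastCases ?_ (fun i => ?_) i <;> simp
    rw [this]
  | neg φ h => simp [rename, Realize, h]

theorem realize_equiv (g : M ≃[L] N) {n : ℕ} (φ : Formula L n) (a : Fin n → M) :
    φ.Realize (g ∘ a) ↔ φ.Realize a := by
  induction φ with
  | rel R ts =>
    simp only [Realize, FirstOrder.Language.HomClass.realize_term]
    exact FirstOrder.Language.StrongHomClass.map_rel g R _
  | equal s t => simp [Realize, FirstOrder.Language.HomClass.realize_term]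
  | top => rfl
  | bot => rfl
  | and φ ψ h h' => simp [Realize, h, h']
  | iSup φ h => simp [Realize, h]
  | ex φ h =>
    simp only [Realize, ← h]
    refine (g.toEquiv.exists_congr fun b => ?_).symm
    rw [Fin.comp_snoc]
    rfl
  | neg φ h => simp [Realize, h]

/-- A block of existential quantifiers. -/
def exs {n : ℕ} : {m : ℕ} → Formula L (n + m) → Formula L n
  | 0, φ => φ
  | _ + 1, φ => exs (ex φ)

theorem IsSigma.exs {α : Ordinal.{0}} {n m : ℕ} {φ : Formula L (n + m)} (h : φ.IsSigma α) :
    φ.exs.IsSigma α := by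
  induction m with
  | zero => exact h
  | succ m ih => exact ih h.ex

@[simp]
theorem realize_exs {n m : ℕ} (φ : Formula L (n + m)) (a : Fin n → M) :
    φ.exs.Realize a ↔ ∃ b : Fin m → M, φ.Realize (Fin.append a b) := by
  induction m with
  | zero =>
    constructor
    · intro h
      refine ⟨Fin.elim0, ?_⟩
      rw [Fin.append_elim0]
      exact h
    · rintro ⟨b, h⟩
      rw [Subsingleton.elim b Fin.elim0, Fin.append_elim0] at h
      exact h
  | succ m ih =>
    rw [exs, ih]
    constructor
    · rintro ⟨b, c, h⟩
      exact ⟨Fin.snoc b c, by rwa [Fin.append_snoc]⟩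
    · rintro ⟨b, h⟩
      refine ⟨Fin.init b, b (Fin.last m), ?_⟩
      rw [← Fin.append_snoc, Fin.snoc_init_self]
      exact h

/-- The existential closure. -/
def exClosure {n : ℕ} (φ : Formula L n) : Formula L 0 :=
  exs (m := n) (φ.rename (Fin.natAdd 0))

theorem IsSigma.exClosure {α : Ordinal.{0}} {n : ℕ} {φ : Formula L n} (h : φ.IsSigma α) :
    φ.exClosure.IsSigma α :=
  (h.rename _).exs

@[simp]
theorem realize_exClosure {n : ℕ} (φ : Formula L n) (a : Fin 0 → M) :
    φ.exClosure.Realize a ↔ ∃ b : Fin n → M, φ.Realize b := by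
  simp only [Formula.exClosure, realize_exs, realize_rename]
  refine exists_congr fun b => ?_
  have : Fin.append a b ∘ Fin.natAdd 0 = b := funext fun i => Fin.append_right a b i
  rw [this]

theorem exists_iSup {α : Ordinal.{0}} (hα : 1 ≤ α) {n : ℕ} {s : Set (Formula L n)}
    (hs : s.Countable) (h : ∀ φ ∈ s, φ.IsSigma α) :
    ∃ φ : Formula L n, φ.IsSigma α ∧ ∀ (M : Type w) [L.Structure M] (a : Fin n → M),
      φ.Realize a ↔ ∃ ψ ∈ s, ψ.Realize a := by
  rcases s.eq_empty_or_nonempty with rfl | hne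
  · exact ⟨bot, .bot hα, fun M _ a => by simp [Realize]⟩
  · obtain ⟨f, rfl⟩ := hs.exists_eq_range hne
    exact ⟨iSup f, .iSup fun i => h _ ⟨i, rfl⟩, fun M _ a => by simp [Realize]⟩

/-- Conjunction of finitely many formulas. -/
def conj {n : ℕ} : {k : ℕ} → (Fin k → Formula L n) → Formula L n
  | 0, _ => top
  | _ + 1, φ => and (φ 0) (conj fun i => φ i.succ)

theorem IsSigma.conj {α : Ordinal.{0}} (hα : 1 ≤ α) {n k : ℕ} {φ : Fin k → Formula L n}
    (h : ∀ i, (φ i).IsSigma α) : (Formula.conj φ).IsSigma α := by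
  induction k with
  | zero => exact .top hα
  | succ k ih => exact .and (h 0) (ih fun i => h i.succ)

@[simp]
theorem realize_conj {n k : ℕ} (φ : Fin k → Formula L n) (a : Fin n → M) :
    (conj φ).Realize a ↔ ∀ i, (φ i).Realize a := by
  induction k with
  | zero => simp [conj, Realize]
  | succ k ih => simp [conj, Realize, ih, Fin.forall_fin_succ]

/-- The formula saying that `x` is the restriction along `f` of a tuple satisfying `φ`. -/
def image {n m : ℕ} (f : Fin n → Fin m) (φ : Formula L m) : Formula L n :=
  exs (m := m) (and (conj fun i : Fin n => equal (.var (Fin.castAdd m i)) (.var (Fin.natAdd n (f i))))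
    (φ.rename (Fin.natAdd n)))

theorem IsSigma.image {α : Ordinal.{0}} {n m : ℕ} {φ : Formula L m} (h : φ.IsSigma α)
    (f : Fin n → Fin m) : (φ.image f).IsSigma α :=
  IsSigma.exs (.and (.conj h.one_le fun _ => .equal h.one_le _ _) (h.rename _))

@[simp]
theorem realize_image {n m : ℕ} (f : Fin n → Fin m) (φ : Formula L m) (a : Fin n → M) :
    (φ.image f).Realize a ↔ ∃ b : Fin m → M, b ∘ f = a ∧ φ.Realize b := by
  simp only [Formula.image, realize_exs, Realize, realize_conj, realize_rename]
  refine exists_congr fun b => ?_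
  have : Fin.append a b ∘ Fin.natAdd n = b := by
    funext i
    simp
  rw [this, funext_iff]
  simp [eq_comm]

/-- Atomic formulas. -/
inductive IsAtomic : {n : ℕ} → Formula L n → Prop
  | rel {n k : ℕ} (R : L.Relations k) (ts : Fin k → L.Term (Fin n)) : IsAtomic (.rel R ts)
  | equal {n : ℕ} (s t : L.Term (Fin n)) : IsAtomic (.equal s t)

theorem IsAtomic.isSigma {α : Ordinal.{0}} (hα : 1 ≤ α) {n : ℕ} {φ : Formula L n}
    (h : φ.IsAtomic) : φ.IsSigma α := by
  cases h with
  | rel R ts => exact .rel hα R ts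
  | equal s t => exact .equal hα s t

theorem countable_isAtomic [Countable L.Symbols] (n : ℕ) :
    {φ : Formula L n | φ.IsAtomic}.Countable := by
  have : Countable (Σ l, L.Functions l) :=
    Function.Injective.countable (f := (Sum.inl : _ → L.Symbols)) Sum.inl_injective
  have : Countable (Σ l, L.Relations l) :=
    Function.Injective.countable (f := (Sum.inr : _ → L.Symbols)) Sum.inr_injective
  have h1 : (Set.range fun q : Σ R : (Σ l, L.Relations l), Fin R.1 → L.Term (Fin n) =>
      (Formula.rel q.1.2 q.2 : Formula L n)).Countable := Set.countable_range _
  have h2 : (Set.range fun q : L.Term (Fin n) × L.Term (Fin n) =>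
      (Formula.equal q.1 q.2 : Formula L n)).Countable := Set.countable_range _
  refine (h1.union h2).mono ?_
  rintro φ (⟨R, ts⟩ | ⟨s, t⟩)
  · exact Or.inl ⟨⟨⟨_, R⟩, ts⟩, rfl⟩
  · exact Or.inr ⟨(s, t), rfl⟩

end Formula

/-! ### Back and forth -/

section BackAndForth

variable {L : FirstOrder.Language.{u, v}} {M : Type w} [L.Structure M] {N : Type w} [L.Structure N]

/-- A correspondence which is total, surjective and preserves atomic formulas is an isomorphism. -/
theorem exists_equiv_of_rel {R : M → N → Prop} (htot : ∀ c, ∃ d, R c d) (hsurj : ∀ d, ∃ c, R c d)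
    (hat : ∀ {k : ℕ} (c : Fin k → M) (d : Fin k → N), (∀ i, R (c i) (d i)) →
      ∀ {φ : Formula L k}, φ.IsAtomic → (φ.Realize c ↔ φ.Realize d)) :
    ∃ g : M ≃[L] N, ∀ c d, R c d → g c = d := by
  have hinj : ∀ {c c' : M} {d d' : N}, R c d → R c' d' → (c = c' ↔ d = d') := by
    intro c c' d d' h1 h2
    have := hat ![c, c'] ![d, d'] (by intro i; fin_cases i <;> assumption)
      (.equal (.var 0) (.var 1))
    simpa [Formula.Realize] using this
  choose g hg using htot
  choose g' hg' using hsurj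
  refine ⟨⟨⟨g, g', fun c => (hinj (hg' _) (hg c)).2 rfl, fun d => (hinj (hg _) (hg' d)).1 rfl⟩,
    fun {k} f c => ?_, fun {k} r c => ?_⟩, fun c d h => (hinj (hg _) h).1 rfl⟩
  · let c' := FirstOrder.Language.Structure.funMap f c
    have := hat (Fin.snoc c c' : Fin (k + 1) → M) (Fin.snoc (g ∘ c) (g c') : Fin (k + 1) → N)
      (by intro i; refine Fin.lastCases ?_ (fun i => ?_) i <;> simp [hg])
      (.equal (.func f fun i => .var i.castSucc) (.var (Fin.last k)))
    simp only [Formula.Realize, FirstOrder.Language.Term.realize_func,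
      FirstOrder.Language.Term.realize_var, Fin.snoc_castSucc, Fin.snoc_last] at this
    exact (this.1 rfl).symm
  · have := hat c (g ∘ c) (fun i => hg _) (.rel r fun i => .var i)
    simp only [Formula.Realize, FirstOrder.Language.Term.realize_var] at this
    exact this.symm

/-- A family of relations between tuples of `M` and `N` with the back-and-forth property. -/
structure IsBackAndForth (L : FirstOrder.Language.{u, v}) {M : Type w} [L.Structure M]
    {N : Type w} [L.Structure N] (I : ∀ n, (Fin n → M) → (Fin n → N) → Prop) : Prop where
  atomic {n : ℕ} {a : Fin n → M} {b : Fin n → N} (h : I n a b) {φ : Formula L n}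
    (hφ : φ.IsAtomic) : φ.Realize a ↔ φ.Realize b
  forth {n : ℕ} {a : Fin n → M} {b : Fin n → N} (h : I n a b) (c : M) :
    ∃ d : N, I (n + 1) (Fin.snoc a c) (Fin.snoc b d)
  back {n : ℕ} {a : Fin n → M} {b : Fin n → N} (h : I n a b) (d : N) :
    ∃ c : M, I (n + 1) (Fin.snoc a c) (Fin.snoc b d)

/-- Pairs of corresponding tuples, ordered by extension. -/
structure PartialMatch (I : ∀ n, (Fin n → M) → (Fin n → N) → Prop) where
  size : ℕ
  left : Fin size → M
  right : Fin size → N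
  rel : I size left right

instance (I : ∀ n, (Fin n → M) → (Fin n → N) → Prop) : Preorder (PartialMatch I) where
  le p q := ∃ f : Fin p.size → Fin q.size, q.left ∘ f = p.left ∧ q.right ∘ f = p.right
  le_refl p := ⟨id, rfl, rfl⟩
  le_trans := by
    rintro p q r ⟨f, h1, h2⟩ ⟨g, h3, h4⟩
    exact ⟨g ∘ f, by rw [← h1, ← h3]; rfl, by rw [← h2, ← h4]; rfl⟩

/-- Forth and back say that the matches containing a given element of M, or of N, are cofinal. An
ideal meeting these countably many cofinal sets gives the isomorphism. -/
theorem IsBackAndForth.exists_equiv [Countable M] [Countable N]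
    {I : ∀ n, (Fin n → M) → (Fin n → N) → Prop} (hI : IsBackAndForth L I)
    {n : ℕ} {a : Fin n → M} {b : Fin n → N} (h : I n a b) : ∃ g : M ≃[L] N, ∀ i, g (a i) = b i := by
  classical
  have : Encodable (M ⊕ N) := Encodable.ofCountable _
  let D : M ⊕ N → Order.Cofinal (PartialMatch I) := fun s =>
    { carrier := {p | Sum.elim (fun c => c ∈ Set.range p.left) (fun d => d ∈ Set.range p.right) s}
      isCofinal := by
        rintro ⟨k, a, b, hab⟩
        rcases s with c | d
        · obtain ⟨d, hd⟩ := hI.forth hab c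
          exact ⟨⟨_, _, _, hd⟩, ⟨Fin.last k, by simp⟩, Fin.castSucc, by funext i; simp,
            by funext i; simp⟩
        · obtain ⟨c, hc⟩ := hI.back hab d
          exact ⟨⟨_, _, _, hc⟩, ⟨Fin.last k, by simp⟩, Fin.castSucc, by funext i; simp,
            by funext i; simp⟩ }
  let J : Order.Ideal (PartialMatch I) := Order.idealOfCofinals ⟨n, a, b, h⟩ D
  have hJ : (⟨n, a, b, h⟩ : PartialMatch I) ∈ J := Order.mem_idealOfCofinals _ _
  have hl : ∀ c : M, ∃ p ∈ J, c ∈ Set.range p.left := fun c => by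
    obtain ⟨p, hp, hp'⟩ := Order.cofinal_meets_idealOfCofinals ⟨n, a, b, h⟩ D (Sum.inl c)
    exact ⟨p, hp', hp⟩
  have hr : ∀ d : N, ∃ p ∈ J, d ∈ Set.range p.right := fun d => by
    obtain ⟨p, hp, hp'⟩ := Order.cofinal_meets_idealOfCofinals ⟨n, a, b, h⟩ D (Sum.inr d)
    exact ⟨p, hp', hp⟩
  let R : M → N → Prop := fun c d => ∃ p ∈ J, ∃ i, p.left i = c ∧ p.right i = d
  -- By directedness finitely many related pairs lie in a single match, where atomic formulas are
  -- preserved.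
  have hdir : ∀ {k : ℕ} (c : Fin k → M) (d : Fin k → N), (∀ i, R (c i) (d i)) →
      ∃ p ∈ J, ∃ f : Fin k → Fin p.size, p.left ∘ f = c ∧ p.right ∘ f = d := by
    intro k
    induction k with
    | zero => exact fun c d _ => ⟨_, hJ, Fin.elim0, Subsingleton.elim _ _, Subsingleton.elim _ _⟩
    | succ k ih =>
      intro c d hcd
      obtain ⟨p, hp, f, hf, hf'⟩ := ih (Fin.init c) (Fin.init d) fun i => hcd i.castSucc
      obtain ⟨q, hq, i, hi, hi'⟩ := hcd (Fin.last k)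
      obtain ⟨r, hr, ⟨s, hs, hs'⟩, ⟨t, ht, ht'⟩⟩ := J.directed p hp q hq
      refine ⟨r, hr, Fin.snoc (s ∘ f) (t i), ?_, ?_⟩
      · funext j
        refine Fin.lastCases ?_ (fun j => ?_) j
        · simp only [Function.comp_apply, Fin.snoc_last]
          rw [← hi, ← ht]
          rfl
        · simp only [Function.comp_apply, Fin.snoc_castSucc]
          rw [show c j.castSucc = Fin.init c j from rfl, ← hf, ← hs]
          rfl
      · funext j
        refine Fin.lastCases ?_ (fun j => ?_) j
        · simp only [Function.comp_apply, Fin.snoc_last]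
          rw [← hi', ← ht']
          rfl
        · simp only [Function.comp_apply, Fin.snoc_castSucc]
          rw [show d j.castSucc = Fin.init d j from rfl, ← hf', ← hs']
          rfl
  have hat : ∀ {k : ℕ} (c : Fin k → M) (d : Fin k → N), (∀ i, R (c i) (d i)) →
      ∀ {φ : Formula L k}, φ.IsAtomic → (φ.Realize c ↔ φ.Realize d) := by
    intro k c d hcd φ hφ
    obtain ⟨p, _, f, rfl, rfl⟩ := hdir c d hcd
    rw [← Formula.realize_rename, ← Formula.realize_rename]
    refine hI.atomic p.rel ?_
    cases hφ with
    | rel R ts => exact .rel _ _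
    | equal s t => exact .equal _ _
  have htot : ∀ c : M, ∃ d, R c d := fun c => by
    obtain ⟨p, hp, i, hi⟩ := hl c
    exact ⟨_, p, hp, i, hi, rfl⟩
  have hsurj : ∀ d : N, ∃ c, R c d := fun d => by
    obtain ⟨p, hp, i, hi⟩ := hr d
    exact ⟨_, p, hp, i, rfl, hi⟩
  obtain ⟨g, hg⟩ := exists_equiv_of_rel htot hsurj hat
  exact ⟨g, fun i => hg _ _ ⟨_, hJ, i, rfl, rfl⟩⟩

end BackAndForth

/-! ### Scott sentences and isolated types -/

section Model

variable {L : FirstOrder.Language.{u, v}} {M : Type w} [L.Structure M]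

theorem exists_scottSentence [Countable L.Symbols] [Countable M] {α : Ordinal.{0}} (hα : 1 ≤ α)
    (h : ∀ (n : ℕ) (a : Fin n → M), ∃ φ : Formula L n, φ.IsSigma α ∧
      ∀ b : Fin n → M, φ.Realize b ↔ ∃ g : M ≃[L] M, ∀ i, g (a i) = b i) :
    ∃ φ : Formula L 0, φ.IsPi (α + 1) ∧ φ.IsScottSentence M := by
  choose Φ hΦ hΦ' using h
  have hlt : α < α + 1 := Order.lt_add_one_iff.2 le_rfl
  have hself : ∀ n (a : Fin n → M), (Φ n a).Realize a := fun n a =>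
    (hΦ' n a a).2 ⟨.refl L M, fun i => rfl⟩
  choose Χ hΧ hΧ' using fun (n : ℕ) (a : Fin n → M) =>
    Formula.exists_iSup.{u, v, w} hα (s := Set.range fun b : M => Φ (n + 1) (Fin.snoc a b))
      (Set.countable_range _) (by rintro _ ⟨b, rfl⟩; exact hΦ _ _)
  -- The sentences to be excluded, all Σ_{α+1}: the empty tuples do not match, forth fails, back
  -- fails, or an atomic formula changes its truth value in either direction.
  let s₁ : Set (Formula L 0) := {.neg (Φ 0 Fin.elim0)}
  let s₂ : Set (Formula L 0) := ⋃ n, Set.range fun q : (Fin n → M) × M =>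
    (Formula.and (Φ n q.1) (.neg (.ex (Φ (n + 1) (Fin.snoc q.1 q.2))))).exClosure
  let s₃ : Set (Formula L 0) := ⋃ n, Set.range fun a : Fin n → M =>
    (Formula.and ((Φ n a).rename Fin.castSucc) (.neg (Χ n a))).exClosure
  let s₄ : Set (Formula L 0) := ⋃ n, ⋃ a : Fin n → M,
    (fun ψ => (Formula.and (Φ n a) (.neg ψ)).exClosure) '' {ψ | ψ.IsAtomic ∧ ψ.Realize a}
  let s₅ : Set (Formula L 0) := ⋃ n, ⋃ a : Fin n → M,
    (fun ψ => (Formula.and (Φ n a) ψ).exClosure) '' {ψ | ψ.IsAtomic ∧ ¬ ψ.Realize a}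
  have hs : (s₁ ∪ s₂ ∪ s₃ ∪ s₄ ∪ s₅).Countable := by
    refine ((((Set.countable_singleton _).union (Set.countable_iUnion fun n =>
      Set.countable_range _)).union (Set.countable_iUnion fun n => Set.countable_range _)).union
      (Set.countable_iUnion fun n => Set.countable_iUnion fun a => Set.Countable.image ?_ _)).union
      (Set.countable_iUnion fun n => Set.countable_iUnion fun a => Set.Countable.image ?_ _)
    · exact (Formula.countable_isAtomic n).mono fun ψ h => h.1
    · exact (Formula.countable_isAtomic n).mono fun ψ h => h.1
  obtain ⟨σ, hσ, hσ'⟩ := Formula.exists_iSup.{u, v, w} (α := α + 1) (hα.trans hlt.le) hs (by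
    rintro φ ((((rfl | h) | h) | h) | h)
    · exact .neg_of_lt hlt (hΦ _ _)
    · obtain ⟨n, q, rfl⟩ := Set.mem_iUnion.1 h
      exact Formula.IsSigma.exClosure (.and ((hΦ _ _).mono hlt.le) (.neg_of_lt hlt (hΦ _ _).ex))
    · obtain ⟨n, a, rfl⟩ := Set.mem_iUnion.1 h
      exact Formula.IsSigma.exClosure
        (.and (((hΦ _ _).rename _).mono hlt.le) (.neg_of_lt hlt (hΧ _ _)))
    · obtain ⟨n, h⟩ := Set.mem_iUnion.1 h
      obtain ⟨a, ψ, hψ, rfl⟩ := Set.mem_iUnion.1 h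
      exact Formula.IsSigma.exClosure
        (.and ((hΦ _ _).mono hlt.le) (.neg_of_lt hlt (hψ.1.isSigma hα)))
    · obtain ⟨n, h⟩ := Set.mem_iUnion.1 h
      obtain ⟨a, ψ, hψ, rfl⟩ := Set.mem_iUnion.1 h
      exact Formula.IsSigma.exClosure
        (.and ((hΦ _ _).mono hlt.le) (hψ.1.isSigma (hα.trans hlt.le))))
  refine ⟨.neg σ, ⟨σ, hσ, rfl⟩, fun N _ _ => ?_⟩
  have hM : ¬ σ.Realize (Fin.elim0 : Fin 0 → M) := by
    rw [hσ']
    rintro ⟨φ, ((((rfl | h) | h) | h) | h), hφ⟩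
    · exact hφ (hself _ _)
    · obtain ⟨n, q, rfl⟩ := Set.mem_iUnion.1 h
      simp only [Formula.realize_exClosure, Formula.Realize] at hφ
      obtain ⟨b, hb, hb'⟩ := hφ
      obtain ⟨g, hg⟩ := (hΦ' _ _ _).1 hb
      refine hb' ⟨g q.2, (hΦ' _ _ _).2 ⟨g, fun i => ?_⟩⟩
      refine Fin.lastCases ?_ (fun i => ?_) i <;> simp [hg]
    · obtain ⟨n, a, rfl⟩ := Set.mem_iUnion.1 h
      simp only [Formula.realize_exClosure, Formula.Realize, Formula.realize_rename] at hφ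
      obtain ⟨b, hb, hb'⟩ := hφ
      obtain ⟨g, hg⟩ := (hΦ' _ _ _).1 hb
      refine hb' ((hΧ' _ _ _ _).2 ⟨_, ⟨g.symm (b (Fin.last n)), rfl⟩,
        (hΦ' _ _ _).2 ⟨g, fun i => ?_⟩⟩)
      refine Fin.lastCases ?_ (fun i => ?_) i <;> simp [hg]
    · obtain ⟨n, h⟩ := Set.mem_iUnion.1 h
      obtain ⟨a, ψ, hψ, rfl⟩ := Set.mem_iUnion.1 h
      simp only [Formula.realize_exClosure, Formula.Realize] at hφ
      obtain ⟨b, hb, hb'⟩ := hφ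
      obtain ⟨g, hg⟩ := (hΦ' _ _ _).1 hb
      rw [← show g ∘ a = b from funext hg, Formula.realize_equiv] at hb'
      exact hb' hψ.2
    · obtain ⟨n, h⟩ := Set.mem_iUnion.1 h
      obtain ⟨a, ψ, hψ, rfl⟩ := Set.mem_iUnion.1 h
      simp only [Formula.realize_exClosure, Formula.Realize] at hφ
      obtain ⟨b, hb, hb'⟩ := hφ
      obtain ⟨g, hg⟩ := (hΦ' _ _ _).1 hb
      rw [← show g ∘ a = b from funext hg, Formula.realize_equiv] at hb'
      exact hψ.2 hb'
  constructor
  · intro hN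
    have hN' : ∀ φ ∈ s₁ ∪ s₂ ∪ s₃ ∪ s₄ ∪ s₅, ¬ φ.Realize (Fin.elim0 : Fin 0 → N) :=
      fun φ hφ hr => hN ((hσ' _ _).2 ⟨φ, hφ, hr⟩)
    have hI : IsBackAndForth L fun n (a : Fin n → M) (b : Fin n → N) => (Φ n a).Realize b := by
      constructor
      · intro n a b hab ψ hψ
        constructor
        · intro ha
          by_contra hb
          refine hN' (Formula.and (Φ n a) (.neg ψ)).exClosure (Or.inl (Or.inr (Set.mem_iUnion.2
            ⟨n, Set.mem_iUnion.2 ⟨a, ψ, ⟨hψ, ha⟩, rfl⟩⟩))) ?_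
          exact (Formula.realize_exClosure _ _).2 ⟨b, hab, hb⟩
        · intro hb
          by_contra ha
          refine hN' (Formula.and (Φ n a) ψ).exClosure (Or.inr (Set.mem_iUnion.2
            ⟨n, Set.mem_iUnion.2 ⟨a, ψ, ⟨hψ, ha⟩, rfl⟩⟩)) ?_
          exact (Formula.realize_exClosure _ _).2 ⟨b, hab, hb⟩
      · intro n a b hab c
        by_contra hd
        refine hN' _ (Or.inl (Or.inl (Or.inl (Or.inr (Set.mem_iUnion.2 ⟨n, (a, c), rfl⟩))))) ?_
        exact (Formula.realize_exClosure _ _).2 ⟨b, hab, hd⟩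
      · intro n a b hab d
        by_contra hc
        refine hN' _ (Or.inl (Or.inl (Or.inr (Set.mem_iUnion.2 ⟨n, a, rfl⟩)))) ?_
        refine (Formula.realize_exClosure _ _).2 ⟨Fin.snoc b d, ?_, fun hX => hc ?_⟩
        · rw [Formula.realize_rename]
          convert hab
          funext i
          simp
        · obtain ⟨_, ⟨c, rfl⟩, hc⟩ := (hΧ' _ _ _ _).1 hX
          exact ⟨c, hc⟩
    have h0 : (Φ 0 Fin.elim0).Realize (Fin.elim0 : Fin 0 → N) :=
      not_not.1 (hN' _ (Or.inl (Or.inl (Or.inl (Or.inl rfl)))))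
    obtain ⟨g, _⟩ := hI.exists_equiv h0
    exact ⟨g⟩
  · rintro ⟨g⟩ hN
    rw [Subsingleton.elim (Fin.elim0 : Fin 0 → N) (g ∘ Fin.elim0), Formula.realize_equiv] at hN
    exact hM hN

/-- The formula θ obtained for a is true at a, and each of its realizations has its Σ_α type
contained in that of a. If b realizes θ for a, then a realizes θ for b, so the types are equal;
types of extended tuples are then matched by the quantifier ∃. -/
theorem exists_isSigma_orbit [Countable M] {α : Ordinal.{0}} (hα : 1 ≤ α)
    (h : ∀ (n : ℕ) (ψ : Formula L n), ψ.IsPi α → (∃ a : Fin n → M, ψ.Realize a) →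
        ∃ θ : Formula L n, θ.IsSigma α ∧ (∃ a : Fin n → M, θ.Realize a) ∧
          ∀ a : Fin n → M, θ.Realize a → ψ.Realize a) (n : ℕ) (a : Fin n → M) :
    ∃ φ : Formula L n, φ.IsSigma α ∧
      ∀ b : Fin n → M, φ.Realize b ↔ ∃ g : M ≃[L] M, ∀ i, g (a i) = b i := by
  have key : ∀ (n : ℕ) (a : Fin n → M), ∃ θ : Formula L n, θ.IsSigma α ∧ θ.Realize a ∧
      ∀ b : Fin n → M, θ.Realize b → ∀ σ : Formula L n, σ.IsSigma α → σ.Realize b →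
        σ.Realize a := by
    intro n a
    have hsep : ∀ b : Fin n → M, ∃ σ : Formula L n, σ.IsSigma α ∧ ¬ σ.Realize a ∧
        ((∃ τ : Formula L n, τ.IsSigma α ∧ ¬ τ.Realize a ∧ τ.Realize b) → σ.Realize b) := by
      intro b
      by_cases hb : ∃ τ : Formula L n, τ.IsSigma α ∧ ¬ τ.Realize a ∧ τ.Realize b
      · obtain ⟨τ, h1, h2, h3⟩ := hb
        exact ⟨τ, h1, h2, fun _ => h3⟩
      · exact ⟨.bot, .bot hα, id, fun h => absurd h hb⟩
    choose σ hσ hσa hσb using hsep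
    obtain ⟨τ, hτ, hτ'⟩ := Formula.exists_iSup.{u, v, w} hα (Set.countable_range σ)
      (by rintro _ ⟨b, rfl⟩; exact hσ b)
    have hτa : ¬ τ.Realize a := by
      rw [hτ']
      rintro ⟨_, ⟨b, rfl⟩, hb⟩
      exact hσa b hb
    have hle : ∀ b : Fin n → M, ¬ τ.Realize b → ∀ σ : Formula L n, σ.IsSigma α → σ.Realize b →
        σ.Realize a := by
      intro b hb ρ hρ hρb
      by_contra hρa
      exact hb ((hτ' _ _).2 ⟨_, ⟨b, rfl⟩, hσb b ⟨ρ, hρ, hρa, hρb⟩⟩)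
    -- The witness b may differ from a, but θ belongs to the Σ_α type of b, hence to that of a.
    obtain ⟨θ, hθ, ⟨b, hb⟩, hθ'⟩ := h n (.neg τ) ⟨τ, hτ, rfl⟩ ⟨a, hτa⟩
    exact ⟨θ, hθ, hle b (hθ' b hb) θ hθ hb, fun c hc => hle c (hθ' c hc)⟩
  choose θ hθ hself hle using key
  have hsymm : ∀ (n : ℕ) (a b : Fin n → M), (θ n a).Realize b → ∀ σ : Formula L n,
      σ.IsSigma α → (σ.Realize a ↔ σ.Realize b) := by
    intro n a b hab σ hσ
    refine ⟨fun ha => ?_, hle n a b hab σ hσ⟩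
    exact hle n b a (hle n a b hab _ (hθ n b) (hself n b)) σ hσ ha
  have hI : IsBackAndForth L fun n (a b : Fin n → M) => (θ n a).Realize b := by
    have forth : ∀ {n : ℕ} {a b : Fin n → M}, (θ n a).Realize b → ∀ c : M,
        ∃ d : M, (θ (n + 1) (Fin.snoc a c)).Realize (Fin.snoc b d : Fin (n + 1) → M) :=
      fun {n a b} hab c => (hsymm n a b hab (.ex (θ (n + 1) (Fin.snoc a c))) (hθ _ _).ex).1
        ⟨c, hself _ _⟩
    refine ⟨fun {n a b} hab φ hφ => hsymm n a b hab φ (hφ.isSigma hα), forth,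
      fun {n a b} hab d => ?_⟩
    obtain ⟨c, hc⟩ := forth ((hsymm n a b hab _ (hθ n b)).2 (hself n b)) d
    exact ⟨c, (hsymm _ _ _ hc _ (hθ _ _)).2 (hself _ _)⟩
  refine ⟨θ n a, hθ n a, fun b => ⟨fun hb => hI.exists_equiv hb, ?_⟩⟩
  rintro ⟨g, hg⟩
  rw [← show g ∘ a = b from funext hg, Formula.realize_equiv]
  exact hself n a

end Model

/-! ### Fiber powers of étale spaces -/

section Sheets

variable {X : Type z} {M : Type w} [TopologicalSpace M] [SecondCountableTopology M]

/-- The members of a countable basis on which `f` is injective. -/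
def sheets (f : M → X) : Set (Set M) := {W ∈ countableBasis M | Set.InjOn f W}

theorem countable_sheets (f : M → X) : (sheets f).Countable :=
  (countable_countableBasis M).mono fun _ h => h.1

theorem isOpen_of_mem_sheets {f : M → X} {W : Set M} (h : W ∈ sheets f) : IsOpen W :=
  isOpen_of_mem_countableBasis h.1

theorem exists_mem_sheets {f : M → X} (hf : IsLocallyInjective f) {V : Set M} (hV : IsOpen V)
    {a : M} (ha : a ∈ V) : ∃ W ∈ sheets f, a ∈ W ∧ W ⊆ V := by
  obtain ⟨U, hU, haU, hi⟩ := hf a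
  obtain ⟨W, hW, haW, hWU⟩ := (isBasis_countableBasis M).exists_subset_of_mem_open
    (⟨haU, ha⟩ : a ∈ U ∩ V) (hU.inter hV)
  exact ⟨W, ⟨hW, hi.mono (hWU.trans Set.inter_subset_left)⟩, haW,
    hWU.trans Set.inter_subset_right⟩

end Sheets

namespace FiberPower

variable {X : Type z} {M : Type w} {p : M → X}

/-- The base point of a point of a fiber power. -/
def base {n : ℕ} (q : FiberPower p n) : X := q.1.1

/-- Reindexing of tuples. -/
def comap {n m : ℕ} (f : Fin n → Fin m) (q : FiberPower p m) : FiberPower p n :=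
  ⟨(q.1.1, q.1.2 ∘ f), fun i => q.2 (f i)⟩

variable [TopologicalSpace X] [TopologicalSpace M]

theorem continuous_base {n : ℕ} : Continuous (base : FiberPower p n → X) :=
  continuous_fst.comp continuous_subtype_val

theorem continuous_comap {n m : ℕ} (f : Fin n → Fin m) :
    Continuous (comap f : FiberPower p m → FiberPower p n) := by
  refine Continuous.subtype_mk (continuous_base.prodMk (continuous_pi fun i => ?_)) _
  exact (continuous_apply (f i)).comp (continuous_snd.comp continuous_subtype_val)

theorem continuous_coord {n : ℕ} (i : Fin n) : Continuous fun q : FiberPower p n => q.1.2 i :=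
  (continuous_apply i).comp (continuous_snd.comp continuous_subtype_val)

instance [SecondCountableTopology X] [SecondCountableTopology M] (n : ℕ) :
    SecondCountableTopology (FiberPower p n) :=
  TopologicalSpace.Subtype.secondCountableTopology {q : X × (Fin n → M) | ∀ i, p (q.2 i) = q.1}

theorem isLocallyInjective_base (hp : IsLocallyInjective p) (n : ℕ) :
    IsLocallyInjective (base : FiberPower p n → X) := by
  intro q
  choose U hU hq hi using fun i => hp (q.1.2 i)
  refine ⟨⋂ i, (fun q : FiberPower p n => q.1.2 i) ⁻¹' U i,
    isOpen_iInter_of_finite fun i => (hU i).preimage (continuous_coord i),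
    Set.mem_iInter.2 hq, ?_⟩
  intro r hr s hs h
  refine Subtype.ext (Prod.ext h (funext fun i => hi i (Set.mem_iInter.1 hr i)
    (Set.mem_iInter.1 hs i) ?_))
  rw [r.2 i, s.2 i]
  exact h

/-- A local section of p through the last coordinate extends all nearby n-tuples. -/
theorem isOpenMap_init (hp : IsLocalHomeomorph p) (n : ℕ) :
    IsOpenMap (comap Fin.castSucc : FiberPower p (n + 1) → FiberPower p n) := by
  rintro _ ⟨V, hV, rfl⟩
  rw [isOpen_iff_mem_nhds]
  rintro _ ⟨q, hq, rfl⟩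
  let e := hp.localInverseAt (q.1.2 (Fin.last n))
  have hbase : p (q.1.2 (Fin.last n)) = q.1.1 := q.2 _
  have hmem : q.1.1 ∈ e.source := by
    rw [← hbase]
    exact hp.apply_self_mem_localInverseAt_source
  let t : FiberPower p n → X × (Fin (n + 1) → M) := fun r =>
    (r.1.1, Fin.snoc r.1.2 (e r.1.1))
  have htq : t (comap Fin.castSucc q) = q.1 := by
    refine Prod.ext rfl (funext fun i => ?_)
    refine Fin.lastCases ?_ (fun i => ?_) i
    · simp only [t, comap, Fin.snoc_last]
      rw [← hbase]
      exact hp.localInverseAt_apply_self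
    · simp [t, comap]
  have ht : ContinuousAt t (comap Fin.castSucc q) := by
    refine (continuous_base.continuousAt).prodMk (ContinuousAt.finSnoc (A := fun _ => M) ?_ ?_)
    · exact (continuous_snd.comp continuous_subtype_val).continuousAt
    · exact ContinuousAt.comp (f := base) (g := e) (e.continuousAt hmem)
        continuous_base.continuousAt
  have h1 : ∀ᶠ r in 𝓝 (comap Fin.castSucc q), t r ∈ V :=
    ht.eventually_mem (by rw [htq]; exact hV.mem_nhds hq)
  have h2 : ∀ᶠ r : FiberPower p n in 𝓝 (comap Fin.castSucc q), r.base ∈ e.source :=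
    continuous_base.continuousAt.eventually_mem (e.open_source.mem_nhds hmem)
  filter_upwards [h1, h2] with r hr hr'
  refine ⟨⟨t r, fun i => ?_⟩, hr, Subtype.ext (Prod.ext rfl (funext fun i => ?_))⟩
  · refine Fin.lastCases ?_ (fun i => ?_) i
    · simp only [t, Fin.snoc_last]
      exact hp.apply_localInverseAt_of_mem hr'
    · simp only [t, Fin.snoc_castSucc]
      exact r.2 i
  · simp [t, comap]

theorem isOpenMap_base (hp : IsLocalHomeomorph p) (n : ℕ) :
    IsOpenMap (base : FiberPower p n → X) := by
  induction n with
  | zero =>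
    intro V hV
    have : base '' V = (fun x : X => (⟨(x, Fin.elim0), fun i => i.elim0⟩ : FiberPower p 0)) ⁻¹' V := by
      ext x
      constructor
      · rintro ⟨q, hq, rfl⟩
        have : (⟨(q.base, Fin.elim0), fun i => i.elim0⟩ : FiberPower p 0) = q :=
          Subtype.ext (Prod.ext rfl (Subsingleton.elim _ _))
        rwa [Set.mem_preimage, this]
      · intro hx
        exact ⟨_, hx, rfl⟩
    rw [this]
    exact hV.preimage (Continuous.subtype_mk (continuous_id.prodMk continuous_const) _)
  | succ n ih => exact ih.comp (isOpenMap_init hp n)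

end FiberPower

/-! ### Borel complexity of definable sets and of orbits -/

theorem BorelSigma.biUnion {X : Type z} [TopologicalSpace X] {α : Ordinal.{0}} (hα : 1 ≤ α)
    {ι : Type*} {s : Set ι} (hs : s.Countable) {A : ι → Set X}
    (h : ∀ i ∈ s, BorelSigma α (A i)) : BorelSigma α (⋃ i ∈ s, A i) := by
  rcases s.eq_empty_or_nonempty with rfl | hne
  · simpa using (BorelSigma.of_isOpen isOpen_empty).mono hα
  · obtain ⟨f, rfl⟩ := hs.exists_eq_range hne
    rw [Set.biUnion_range]
    exact BorelSigma.iUnion fun i => h _ ⟨i, rfl⟩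

namespace EtaleStructure

variable {X : Type z} [TopologicalSpace X] {M : Type w} [TopologicalSpace M]
  {L : FirstOrder.Language.{u, v}} {p : M → X} (E : EtaleStructure L p)

include E in
theorem isLocallyInjective_base (n : ℕ) :
    IsLocallyInjective (FiberPower.base : FiberPower p n → X) :=
  FiberPower.isLocallyInjective_base E.isLocalHomeomorph.isLocallyInjective n

/-- A sheet meets each fiber in at most one point, and there are countably many sheets. -/
theorem countable_fiber [SecondCountableTopology M] (x : X) : Countable (E.Fiber x) := by
  have : Countable (sheets p) := (countable_sheets p).to_subtype
  choose W hW ha _ using fun a : E.Fiber x =>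
    exists_mem_sheets E.isLocalHomeomorph.isLocallyInjective isOpen_univ (Set.mem_univ a.1)
  refine Function.Injective.countable (f := fun a => (⟨W a, hW a⟩ : sheets p)) fun a b h => ?_
  have h' : W a = W b := congrArg Subtype.val h
  exact Subtype.ext ((hW a).2 (ha a) (h' ▸ ha b) (a.2.trans b.2.symm))

theorem continuous_term {n : ℕ} (t : L.Term (Fin n)) :
    Continuous fun q : FiberPower p n => (t.realize (E.toTuple q)).1 := by
  induction t with
  | var i => exact FiberPower.continuous_coord i
  | func f ts ih =>
    exact (E.continuous_funMap f).comp (Continuous.subtype_mk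
      (FiberPower.continuous_base.prodMk (continuous_pi ih)) fun q i =>
        ((ts i).realize (E.toTuple q)).2)

theorem isOpen_interp_atomic {n : ℕ} {φ : Formula L n} (h : φ.IsAtomic) :
    IsOpen (E.interp φ) := by
  cases h with
  | rel R ts =>
    exact (E.isOpen_relMap R).preimage (Continuous.subtype_mk
      (FiberPower.continuous_base.prodMk (continuous_pi fun i => E.continuous_term (ts i)))
        fun q i => ((ts i).realize (E.toTuple q)).2)
  | equal s t =>
    -- Two continuous lifts along a locally injective map agree on an open set, so equations are
    -- open conditions.
    have := E.isLocalHomeomorph.isLocallyInjective.isOpen_eqLocus (E.continuous_term s)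
      (E.continuous_term t) (funext fun q =>
        (s.realize (E.toTuple q)).2.trans (t.realize (E.toTuple q)).2.symm)
    convert this using 1
    ext q
    exact Subtype.ext_iff

theorem interp_ex {n : ℕ} (φ : Formula L (n + 1)) :
    E.interp (.ex φ) = FiberPower.comap Fin.castSucc '' E.interp φ := by
  ext q
  constructor
  · rintro ⟨b, hb⟩
    refine ⟨E.toPower (Fin.snoc (E.toTuple q) b), hb, Subtype.ext (Prod.ext rfl (funext fun i => ?_))⟩
    simp [FiberPower.comap, toPower, toTuple]
  · rintro ⟨r, hr, rfl⟩
    refine ⟨E.toTuple r (Fin.last n), ?_⟩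
    exact (iff_of_eq (congrArg φ.Realize (Fin.snoc_init_self (E.toTuple r)))).2 hr

theorem borelSigma_interp [SecondCountableTopology X] [SecondCountableTopology M]
    {α : Ordinal.{0}} {n : ℕ} {φ : Formula L n} (h : φ.IsSigma α) :
    BorelSigma α (E.interp φ) := by
  induction h with
  | rel h R ts => exact (BorelSigma.of_isOpen (E.isOpen_interp_atomic (.rel R ts))).mono h
  | equal h s t => exact (BorelSigma.of_isOpen (E.isOpen_interp_atomic (.equal s t))).mono h
  | top h => exact (BorelSigma.of_isOpen isOpen_univ).mono h
  | bot h => exact (BorelSigma.of_isOpen isOpen_empty).mono h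
  | and _ _ h h' => exact h.inter h'
  | @iSup α n φ _ h =>
    convert BorelSigma.iUnion h using 1
    ext q
    simp [interp, Formula.Realize]
  | @ex α n φ hφ h =>
    rw [E.interp_ex]
    have : FiberPower.comap Fin.castSucc '' E.interp φ =
        ⋃ W ∈ sheets (FiberPower.base : FiberPower p (n + 1) → X),
          (FiberPower.comap Fin.castSucc '' (E.interp φ ∩ W) : Set (FiberPower p n)) := by
      ext q
      simp only [Set.mem_iUnion]
      constructor
      · rintro ⟨r, hr, rfl⟩
        obtain ⟨W, hW, hrW, _⟩ := exists_mem_sheets (E.isLocallyInjective_base (n + 1)) isOpen_univ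
          (Set.mem_univ r)
        exact ⟨W, hW, r, ⟨hr, hrW⟩, rfl⟩
      · rintro ⟨W, hW, r, ⟨hr, hrW⟩, rfl⟩
        exact ⟨r, hr, rfl⟩
    rw [this]
    refine BorelSigma.biUnion hφ.one_le (countable_sheets _) fun W hW => ?_
    refine h.image_inter_of_injOn (FiberPower.isOpenMap_init E.isLocalHomeomorph n)
      (isOpen_of_mem_sheets hW) fun r hr s hs e => hW.2 hr hs ?_
    exact congrArg (FiberPower.base (n := n)) e
  | of_lt h _ h' => exact h'.mono h.le
  | neg_of_lt h _ h' => exact h'.compl_of_lt h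

theorem borelPi_orbit [SecondCountableTopology X] [SecondCountableTopology M] {α : Ordinal.{0}}
    {x : X} {φ : Formula L 0} (hφ : φ.IsPi α) (hφ' : φ.IsScottSentence (E.Fiber x)) :
    BorelPi α (E.orbit x) := by
  obtain ⟨σ, hσ, rfl⟩ := hφ
  have hc : Continuous fun x : X => (⟨(x, Fin.elim0), fun i => i.elim0⟩ : FiberPower p 0) :=
    Continuous.subtype_mk (continuous_id.prodMk continuous_const) _
  have := (E.borelSigma_interp hσ).preimage hc
  rw [BorelPi]
  convert this using 1
  ext y
  have hy : Countable (E.Fiber y) := E.countable_fiber y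
  have := hφ' (E.Fiber y)
  simp only [orbit, Set.mem_compl_iff, Set.mem_ofPred_eq, Set.mem_preimage, interp]
  rw [← this, Formula.Realize, not_not]
  have e : (Fin.elim0 : Fin 0 → E.Fiber y) =
    E.toTuple (⟨(y, Fin.elim0), fun i => i.elim0⟩ : FiberPower p 0) := Subsingleton.elim _ _
  rw [e]

end EtaleStructure

/-! ### Generic isomorphisms -/

namespace EtaleStructure

variable {X : Type z} [TopologicalSpace X] {M : Type w} [TopologicalSpace M]
  {L : FirstOrder.Language.{u, v}} {p : M → X} (E : EtaleStructure L p)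

/-- Invariance under isomorphisms between fibers. -/
def Invariant {n : ℕ} (P : Set (FiberPower p n)) : Prop :=
  ∀ ⦃x y : X⦄ (g : E.Fiber x ≃[L] E.Fiber y) (a : Fin n → E.Fiber x),
    E.toPower a ∈ P → E.toPower (g ∘ a) ∈ P

theorem toPower_mem_interp {n : ℕ} {φ : Formula L n} {x : X} {a : Fin n → E.Fiber x} :
    E.toPower a ∈ E.interp φ ↔ φ.Realize a := Iff.rfl

theorem invariant_interp {n : ℕ} (φ : Formula L n) : E.Invariant (E.interp φ) := fun _ _ g a h =>
  (Formula.realize_equiv g φ a).2 h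

theorem Invariant.compl {E : EtaleStructure L p} {n : ℕ} {P : Set (FiberPower p n)}
    (h : E.Invariant P) : E.Invariant Pᶜ := by
  intro x y g a ha ha'
  have := h g.symm _ ha'
  rw [show g.symm ∘ g ∘ a = a from funext fun i => g.symm_apply_apply _] at this
  exact ha this

/-- `Z` is open in the topology on `X` generated by the projections of the intersections of open
and invariant sets, and it is dense in this topology. -/
structure IsDenseOpen (Z : Set X) : Prop where
  exists_subset : ∀ x ∈ Z, ∃ (n : ℕ) (V P : Set (FiberPower p n)), IsOpen V ∧ E.Invariant P ∧
    (∃ c : Fin n → E.Fiber x, E.toPower c ∈ V ∧ E.toPower c ∈ P) ∧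
    ∀ (y : X) (c : Fin n → E.Fiber y), E.toPower c ∈ V → E.toPower c ∈ P → y ∈ Z
  dense : ∀ (x : X) (n : ℕ) (V : Set (FiberPower p n)) (a : Fin n → E.Fiber x), IsOpen V →
    E.toPower a ∈ V → ∃ y ∈ Z, ∃ g : E.Fiber x ≃[L] E.Fiber y, E.toPower (g ∘ a) ∈ V

/-- `G` contains a countable intersection of dense open sets in the sense of `IsDenseOpen`. -/
def IsComeager (G : Set X) : Prop :=
  ∃ 𝒵 : Set (Set X), 𝒵.Countable ∧ (∀ Z ∈ 𝒵, E.IsDenseOpen Z) ∧ ⋂₀ 𝒵 ⊆ G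

variable {E}

theorem IsDenseOpen.isComeager {Z : Set X} (h : E.IsDenseOpen Z) : E.IsComeager Z :=
  ⟨{Z}, Set.countable_singleton Z, by rintro _ rfl; exact h, by simp⟩

theorem IsComeager.mono {G H : Set X} (h : E.IsComeager G) (hGH : G ⊆ H) : E.IsComeager H := by
  obtain ⟨𝒵, hc, hd, hG⟩ := h
  exact ⟨𝒵, hc, hd, hG.trans hGH⟩

theorem IsComeager.iInter {G : ℕ → Set X} (h : ∀ i, E.IsComeager (G i)) :
    E.IsComeager (⋂ i, G i) := by
  choose 𝒵 hc hd hG using h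
  refine ⟨⋃ i, 𝒵 i, Set.countable_iUnion hc, fun Z hZ => ?_, Set.subset_iInter fun i => ?_⟩
  · obtain ⟨i, hi⟩ := Set.mem_iUnion.1 hZ
    exact hd i Z hi
  · exact (Set.sInter_subset_sInter (Set.subset_iUnion 𝒵 i)).trans (hG i)

theorem IsComeager.inter {G H : Set X} (hG : E.IsComeager G) (hH : E.IsComeager H) :
    E.IsComeager (G ∩ H) := by
  obtain ⟨𝒵, hc, hd, h⟩ := hG
  obtain ⟨𝒵', hc', hd', h'⟩ := hH
  exact ⟨𝒵 ∪ 𝒵', hc.union hc', fun Z hZ => hZ.elim (hd Z) (hd' Z), Set.subset_inter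
    ((Set.sInter_subset_sInter Set.subset_union_left).trans h)
    ((Set.sInter_subset_sInter Set.subset_union_right).trans h')⟩

section Code

variable [SecondCountableTopology M] {x : X} (enc : E.Fiber x × sheets p → ℕ)

/-- An isomorphism from the fiber over `x`, as a point of `X × S^ℕ`. -/
def code {y : X} (g : E.Fiber x ≃[L] E.Fiber y) : X × (ℕ → Prop) :=
  (y, fun j => ∃ (a : E.Fiber x) (W : sheets p), enc (a, W) = j ∧ (g a).1 ∈ W.1)

/-- The codes which send the tuple `a` into `V`. -/
def sendsTo {n : ℕ} (a : Fin n → E.Fiber x) (V : Set (FiberPower p n)) : Set (X × (ℕ → Prop)) :=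
  {q | ∃ κ : Fin n → sheets p, (∀ i, q.2 (enc (a i, κ i))) ∧
    ∃ r : Fin n → E.Fiber q.1, E.toPower r ∈ V ∧ ∀ i, (r i).1 ∈ (κ i).1}

theorem isOpen_coord (j : ℕ) : IsOpen {q : X × (ℕ → Prop) | q.2 j} := by
  have : {q : X × (ℕ → Prop) | q.2 j} = (fun q => q.2 j) ⁻¹' {True} := by
    ext q
    simp
  rw [this]
  exact isOpen_singleton_true.preimage ((continuous_apply j).comp continuous_snd)

theorem isOpen_sendsTo {n : ℕ} (a : Fin n → E.Fiber x) {V : Set (FiberPower p n)}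
    (hV : IsOpen V) : IsOpen (sendsTo enc a V) := by
  have : sendsTo enc a V = ⋃ κ : Fin n → sheets p, (⋂ i, {q : X × (ℕ → Prop) | q.2 (enc (a i, κ i))}) ∩
      Prod.fst ⁻¹' (FiberPower.base '' (V ∩ ⋂ i, (fun r : FiberPower p n => r.1.2 i) ⁻¹' (κ i).1)) := by
    ext q
    simp only [sendsTo, Set.mem_ofPred_eq, Set.mem_iUnion, Set.mem_inter_iff, Set.mem_iInter,
      Set.mem_preimage, Set.mem_image]
    refine exists_congr fun κ => and_congr_right fun _ => ?_
    constructor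
    · rintro ⟨r, hr, hr'⟩
      exact ⟨E.toPower r, ⟨hr, hr'⟩, rfl⟩
    · rintro ⟨r, ⟨hr, hr'⟩, h⟩
      obtain ⟨y, c⟩ := q
      obtain rfl : r.base = y := h
      exact ⟨E.toTuple r, hr, hr'⟩
  rw [this]
  refine isOpen_iUnion fun κ => (isOpen_iInter_of_finite fun i => isOpen_coord _).inter
    (IsOpen.preimage continuous_fst (FiberPower.isOpenMap_base E.isLocalHomeomorph n _
      (hV.inter (isOpen_iInter_of_finite fun i =>
        (isOpen_of_mem_sheets (κ i).2).preimage (FiberPower.continuous_coord i)))))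

variable {enc}

/-- A sheet containing g(a) determines g(a) within its fiber, so the sheets recorded by the code
recover the values of g. -/
theorem code_mem_sendsTo (henc : Function.Injective enc) {y : X} (g : E.Fiber x ≃[L] E.Fiber y)
    {n : ℕ} (a : Fin n → E.Fiber x) (V : Set (FiberPower p n)) :
    code enc g ∈ sendsTo enc a V ↔ E.toPower (g ∘ a) ∈ V := by
  constructor
  · rintro ⟨κ, hκ, r, hr, hr'⟩
    have : g ∘ a = r := by
      funext i
      obtain ⟨b, W, hb, hW⟩ := hκ i
      obtain ⟨rfl, rfl⟩ := Prod.mk.inj (henc hb)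
      exact Subtype.ext ((κ i).2.2 hW (hr' i) ((g (a i)).2.trans (r i).2.symm))
    rwa [this]
  · intro h
    choose W hW hg _ using fun i => exists_mem_sheets
      E.isLocalHomeomorph.isLocallyInjective isOpen_univ (Set.mem_univ (g (a i)).1)
    exact ⟨fun i => ⟨W i, hW i⟩, fun i => ⟨a i, ⟨W i, hW i⟩, rfl, hg i⟩, g ∘ a, h, hg⟩

/-- Codes are determined locally by the values at finite tuples. -/
theorem exists_forall_code_mem {y : X} (g : E.Fiber x ≃[L] E.Fiber y)
    {S : Set (X × (ℕ → Prop))} (hS : IsOpen S) (hg : code enc g ∈ S) :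
    ∃ (n : ℕ) (a : Fin n → E.Fiber x) (V : Set (FiberPower p n)), IsOpen V ∧
      E.toPower (g ∘ a) ∈ V ∧ ∀ (y' : X) (g' : E.Fiber x ≃[L] E.Fiber y'),
        E.toPower (g' ∘ a) ∈ V → code enc g' ∈ S := by
  obtain ⟨U, O, hU, hO, hgU, hgO, hUO⟩ := isOpen_prod_iff.1 hS _ _ hg
  obtain ⟨s, hs, hsO⟩ := exists_cylinder_subset hO hgO
  choose a W he hW using fun j : s => hs j.1 j.2
  let k := s.equivFin.symm
  refine ⟨s.card, a ∘ k, FiberPower.base ⁻¹' U ∩ ⋂ i, (fun r => r.1.2 i) ⁻¹' (W (k i)).1,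
    (hU.preimage FiberPower.continuous_base).inter (isOpen_iInter_of_finite fun i =>
      (isOpen_of_mem_sheets (W (k i)).2).preimage (FiberPower.continuous_coord i)),
    ⟨hgU, Set.mem_iInter.2 fun i => hW (k i)⟩, fun y' g' h => hUO ⟨h.1, hsO fun j hj => ?_⟩⟩
  refine ⟨a ⟨j, hj⟩, W ⟨j, hj⟩, he _, ?_⟩
  have := Set.mem_iInter.1 h.2 (k.symm ⟨j, hj⟩)
  simpa [toPower] using this

end Code

/-- A Baire category theorem for the isomorphisms out of M_x. The code of an isomorphism is built
generically in X × S^ℕ; the requirements make it total, single-valued, surjective and faithful to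
atomic formulas, and put its target in every `Z ∈ 𝒵`. -/
theorem IsComeager.exists_mem [QuasiPolishSpace X] [SecondCountableTopology M] [Countable L.Symbols]
    {G : Set X} (hG : E.IsComeager G) {x : X} {n : ℕ} {a : Fin n → E.Fiber x}
    {V : Set (FiberPower p n)} (hV : IsOpen V) (ha : E.toPower a ∈ V) :
    ∃ y ∈ G, ∃ g : E.Fiber x ≃[L] E.Fiber y, E.toPower (g ∘ a) ∈ V := by
  obtain ⟨𝒵, hc, hd, hG⟩ := hG
  have h1 : Countable (E.Fiber x) := E.countable_fiber x
  have h2 : Countable (sheets p) := (countable_sheets p).to_subtype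
  obtain ⟨enc, henc⟩ := exists_injective_nat (E.Fiber x × sheets p)
  obtain ⟨e, he, hr⟩ := QuasiPolishSpace.exists_isEmbedding (X × (ℕ → Prop))
  let K : Set (X × (ℕ → Prop)) :=
    {q | ∃ (y : X) (g : E.Fiber x ≃[L] E.Fiber y), q = code enc g}
  let B₁ : E.Fiber x → Set (X × (ℕ → Prop)) := fun a => sendsTo enc (fun _ : Fin 1 => a) Set.univ
  let A₂ : E.Fiber x × sheets p × sheets p → Set (X × (ℕ → Prop)) := fun t =>
    {q | q.2 (enc (t.1, t.2.1))} ∩ {q | q.2 (enc (t.1, t.2.2))}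
  let B₂ : E.Fiber x × sheets p × sheets p → Set (X × (ℕ → Prop)) := fun t =>
    Prod.fst ⁻¹' (p '' (t.2.1.1 ∩ t.2.2.1))
  let A₃ : sheets p → Set (X × (ℕ → Prop)) := fun W => Prod.fst ⁻¹' (p '' W.1)
  let B₃ : sheets p → Set (X × (ℕ → Prop)) := fun W =>
    ⋃ a : E.Fiber x, sendsTo enc (fun _ : Fin 1 => a) {r | r.1.2 0 ∈ W.1}
  let T := Σ n, {φ : Formula L n // φ.IsAtomic} × (Fin n → E.Fiber x)
  have hT : Countable T := by
    have (n : ℕ) : Countable {φ : Formula L n // φ.IsAtomic} :=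
      (Formula.countable_isAtomic n).to_subtype
    infer_instance
  let C : T → Set (X × (ℕ → Prop)) := fun t => {_q | t.2.1.1.Realize t.2.2}
  let D : T → Set (X × (ℕ → Prop)) := fun t => sendsTo enc t.2.2 (E.interp t.2.1.1)
  -- Since P is invariant, membership in P can be tested on the tuple c over x. What remains is that
  -- c is sent into V, an open condition on codes.
  let F : 𝒵 → Set (X × (ℕ → Prop)) := fun Z =>
    {q | ∃ (n : ℕ) (V P : Set (FiberPower p n)) (c : Fin n → E.Fiber x), IsOpen V ∧
      E.Invariant P ∧ (∀ (y : X) (c : Fin n → E.Fiber y), E.toPower c ∈ V → E.toPower c ∈ P →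
        y ∈ Z.1) ∧ E.toPower c ∈ P ∧ q ∈ sendsTo enc c V}
  have hZ : Countable 𝒵 := hc.to_subtype
  let ι := E.Fiber x ⊕ (E.Fiber x × sheets p × sheets p) ⊕ sheets p ⊕ T ⊕ T ⊕ 𝒵
  let A : ι → Set (X × (ℕ → Prop)) := Sum.elim (fun _ => Set.univ) (Sum.elim A₂ (Sum.elim A₃
    (Sum.elim C (Sum.elim D fun _ => Set.univ))))
  let B : ι → Set (X × (ℕ → Prop)) := Sum.elim B₁ (Sum.elim B₂ (Sum.elim B₃
    (Sum.elim D (Sum.elim C F))))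
  have hCo : ∀ t, IsOpen (C t) := fun t => isOpen_const
  have hDo : ∀ t, IsOpen (D t) := fun t => isOpen_sendsTo enc _ (E.isOpen_interp_atomic t.2.1.2)
  have hA : ∀ i, IsOpen (A i) := by
    rintro (a | t | W | t | t | Z)
    · exact isOpen_univ
    · exact (isOpen_coord _).inter (isOpen_coord _)
    · exact (E.isLocalHomeomorph.isOpenMap _ (isOpen_of_mem_sheets W.2)).preimage continuous_fst
    · exact hCo t
    · exact hDo t
    · exact isOpen_univ
  have hB : ∀ i, IsOpen (B i) := by
    rintro (a | t | W | t | t | Z)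
    · exact isOpen_sendsTo enc _ isOpen_univ
    · exact (E.isLocalHomeomorph.isOpenMap _ ((isOpen_of_mem_sheets t.2.1.2).inter
        (isOpen_of_mem_sheets t.2.2.2))).preimage continuous_fst
    · exact isOpen_iUnion fun a => isOpen_sendsTo enc _
        ((isOpen_of_mem_sheets W.2).preimage (FiberPower.continuous_coord 0))
    · exact hDo t
    · exact hCo t
    · rw [isOpen_iff_forall_mem_open]
      rintro q ⟨n, V, P, c, hV, hP, hVP, hc, hq⟩
      exact ⟨sendsTo enc c V, fun q' hq' => ⟨n, V, P, c, hV, hP, hVP, hc, hq'⟩,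
        isOpen_sendsTo enc c hV, hq⟩
  -- Codes of actual isomorphisms already satisfy all requirements except the last kind, which needs
  -- density.
  have htriv : ∀ {A B : Set (X × (ℕ → Prop))}, (∀ (y : X) (g : E.Fiber x ≃[L] E.Fiber y),
      code enc g ∈ A → code enc g ∈ B) → ∀ S : Set (X × (ℕ → Prop)), S ⊆ A → (S ∩ K).Nonempty →
      (S ∩ B ∩ K).Nonempty := by
    rintro A B h S hSA ⟨_, hq, y, g, rfl⟩
    exact ⟨_, ⟨hq, h y g (hSA hq)⟩, y, g, rfl⟩
  have hAB : ∀ i, ∀ S ∈ {U : Set (X × (ℕ → Prop)) | IsOpen U}, S ⊆ A i → (S ∩ K).Nonempty →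
      (S ∩ B i ∩ K).Nonempty := by
    rintro (a | t | W | t | t | Z) S hS
    · exact htriv (fun y g _ => (code_mem_sendsTo henc g _ _).2 (Set.mem_univ _)) S
    · refine htriv (fun y g hg => ?_) S
      obtain ⟨⟨b, W, hb, hW⟩, ⟨b', W', hb', hW'⟩⟩ := hg
      obtain ⟨rfl, rfl⟩ := Prod.mk.inj (henc hb)
      obtain ⟨h, rfl⟩ := Prod.mk.inj (henc hb')
      rw [h] at hW'
      exact ⟨_, ⟨hW, hW'⟩, (g _).2⟩
    · refine htriv (fun y g hg => ?_) S
      obtain ⟨m, hm, hm'⟩ := hg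
      refine Set.mem_iUnion.2 ⟨g.symm ⟨m, hm'⟩, (code_mem_sendsTo henc g _ _).2 ?_⟩
      rw [show (g ∘ fun _ => g.symm ⟨m, hm'⟩) = fun _ : Fin 1 => ⟨m, hm'⟩ from
        funext fun _ => g.apply_symm_apply _]
      exact hm
    · exact htriv (fun y g hg => (code_mem_sendsTo henc g _ _).2
        (E.invariant_interp _ g _ hg)) S
    · refine htriv (fun y g hg => ?_) S
      exact (Formula.realize_equiv g _ _).1 ((code_mem_sendsTo henc g _ _).1 hg)
    · rintro - ⟨_, hq, y, g, rfl⟩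
      obtain ⟨n, a, V, hV, hgV, hS'⟩ := exists_forall_code_mem g hS hq
      obtain ⟨y', hy', g', hg'⟩ := (hd Z.1 Z.2).dense y n V (g ∘ a) hV hgV
      obtain ⟨m, V', P, hV', hP, ⟨c, hcV, hcP⟩, hZ⟩ := (hd Z.1 Z.2).exists_subset y' hy'
      refine ⟨code enc (g'.comp g), ⟨hS' _ _ hg', m, V', P, (g'.comp g).symm ∘ c, hV', hP, hZ,
        hP _ _ hcP, (code_mem_sendsTo henc _ _ _).2 ?_⟩, y', _, rfl⟩
      rw [show (g'.comp g) ∘ (g'.comp g).symm ∘ c = c from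
        funext fun i => (g'.comp g).apply_symm_apply _]
      exact hcV
  obtain ⟨q, hq₀, hq⟩ := exists_generic_point he hr (𝒮 := {U | IsOpen U}) (fun U hU => hU)
    (fun A hA B hB => IsOpen.inter (s := A) (t := B) hA hB) (K := K) (A := A) (B := B)
    (fun i => Decided.of_isOpen he (fun U hU => hU) (hA i))
    (fun i => Decided.of_isOpen he (fun U hU => hU) (hB i)) hB hAB
    (S₀ := sendsTo enc a V) (isOpen_sendsTo enc a hV)
    (Decided.of_isOpen he (fun U hU => hU) (isOpen_sendsTo enc a hV))
    ⟨code enc (.refl L _), (code_mem_sendsTo henc _ _ _).2 ha, x, _, rfl⟩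
  let R : E.Fiber x → E.Fiber q.1 → Prop := fun c d => ∃ W : sheets p, q.2 (enc (c, W)) ∧ d.1 ∈ W.1
  have hfun : ∀ {c d d'}, R c d → R c d' → d = d' := by
    rintro c d d' ⟨W, hW, hd⟩ ⟨W', hW', hd'⟩
    obtain ⟨m, ⟨hm, hm'⟩, hmq⟩ := hq (Sum.inr (Sum.inl (c, W, W'))) ⟨hW, hW'⟩
    exact Subtype.ext ((W.2.2 hd hm (d.2.trans hmq.symm)).trans
      (W'.2.2 hm' hd' (hmq.trans d'.2.symm)))
  have hsend : ∀ {k : ℕ} {c : Fin k → E.Fiber x} {d : Fin k → E.Fiber q.1},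
      (∀ i, R (c i) (d i)) → ∀ V, q ∈ sendsTo enc c V ↔ E.toPower d ∈ V := by
    intro k c d hcd V
    constructor
    · rintro ⟨κ, hκ, r, hr, hr'⟩
      rwa [show d = r from funext fun i => hfun (hcd i) ⟨κ i, hκ i, hr' i⟩]
    · intro h
      choose κ hκ hκ' using hcd
      exact ⟨κ, hκ, d, h, hκ'⟩
  obtain ⟨g, hg⟩ := exists_equiv_of_rel (L := L) (R := R) (fun c => by
      obtain ⟨κ, hκ, r, _, hr⟩ := hq (Sum.inl c) trivial
      exact ⟨r 0, κ 0, hκ 0, hr 0⟩) (fun d => by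
      obtain ⟨W, hW, hdW, _⟩ := exists_mem_sheets E.isLocalHomeomorph.isLocallyInjective
        isOpen_univ (Set.mem_univ d.1)
      obtain ⟨c, hc⟩ := Set.mem_iUnion.1
        (hq (Sum.inr (Sum.inr (Sum.inl ⟨W, hW⟩))) ⟨d.1, hdW, d.2⟩)
      obtain ⟨κ, hκ, r, hr, hr'⟩ := hc
      have : d = r 0 := Subtype.ext (hW.2 hdW hr (d.2.trans (r 0).2.symm))
      exact ⟨c, κ 0, hκ 0, this ▸ hr' 0⟩) (fun {k} c d hcd φ hφ =>
      ⟨fun h => E.toPower_mem_interp.1 <| (hsend hcd (E.interp φ)).1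
        (hq (Sum.inr (Sum.inr (Sum.inr (Sum.inl ⟨k, ⟨φ, hφ⟩, c⟩)))) h),
        fun h => hq (Sum.inr (Sum.inr (Sum.inr (Sum.inr (Sum.inl ⟨k, ⟨φ, hφ⟩, c⟩)))))
          ((hsend hcd (E.interp φ)).2 (E.toPower_mem_interp.2 h))⟩)
  refine ⟨q.1, hG fun Z hZ => ?_, g, ?_⟩
  · obtain ⟨m, V', P, c, hV', hP, hVP, hcP, κ, hκ, r, hr, hr'⟩ :=
      hq (Sum.inr (Sum.inr (Sum.inr (Sum.inr (Sum.inr ⟨Z, hZ⟩))))) trivial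
    refine hVP _ r hr ?_
    rw [← show g ∘ c = r from funext fun i => hg _ _ ⟨κ i, hκ i, hr' i⟩]
    exact hP g c hcP
  · obtain ⟨κ, hκ, r, hr, hr'⟩ := hq₀
    rwa [show g ∘ a = r from funext fun i => hg _ _ ⟨κ i, hκ i, hr' i⟩]

end EtaleStructure

/-! ### Vaught transforms -/

namespace EtaleStructure

variable {X : Type z} [TopologicalSpace X] {M : Type w} [TopologicalSpace M]
  {L : FirstOrder.Language.{u, v}} {p : M → X} (E : EtaleStructure L p)

/-- The subset of a fiber power is definable by a `Σ_α` formula. -/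
def IsSigmaSet (α : Ordinal.{0}) {n : ℕ} (P : Set (FiberPower p n)) : Prop :=
  ∃ φ : Formula L n, φ.IsSigma α ∧ P = E.interp φ

variable {E}

theorem exists_toPower_of_comap_eq {n m : ℕ} {f : Fin n → Fin m} {x : X} {a : Fin n → E.Fiber x}
    {r : FiberPower p m} (h : FiberPower.comap f r = E.toPower a) :
    ∃ b : Fin m → E.Fiber x, r = E.toPower b ∧ b ∘ f = a := by
  obtain ⟨⟨y, c⟩, hc⟩ := r
  obtain rfl : y = x := congrArg (fun q : FiberPower p n => q.1.1) h
  refine ⟨fun i => ⟨c i, hc i⟩, rfl, funext fun i => Subtype.ext ?_⟩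
  exact congrFun (congrArg (fun q : FiberPower p n => q.1.2) h) i

theorem toPower_mem_saturation {n : ℕ} {x : X} {a : Fin n → E.Fiber x}
    {V : Set (FiberPower p n)} : E.toPower a ∈ E.saturation V ↔
      ∃ (y : X) (g : E.Fiber x ≃[L] E.Fiber y), E.toPower (g ∘ a) ∈ V := by
  constructor
  · rintro ⟨q, hq, g, hg⟩
    let g' : E.Fiber q.1.1 ≃[L] E.Fiber x := g
    have hg' : g'.symm ∘ a = E.toTuple q := funext fun i => by
      have : g' (E.toTuple q i) = a i := hg i
      rw [Function.comp_apply, ← this, g'.symm_apply_apply]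
    refine ⟨q.1.1, g'.symm, ?_⟩
    rw [hg']
    exact hq
  · rintro ⟨y, g, h⟩
    exact ⟨_, h, g.symm, fun i => g.symm_apply_apply (a i)⟩

/-! ### Closure properties of definable sets -/

namespace IsSigmaSet

variable {α β : Ordinal.{0}} {n m : ℕ} {P Q : Set (FiberPower p n)}

theorem invariant (h : E.IsSigmaSet α P) : E.Invariant P := by
  obtain ⟨φ, _, rfl⟩ := h
  exact E.invariant_interp φ

theorem mono (h : E.IsSigmaSet β P) (hβ : β ≤ α) : E.IsSigmaSet α P := by
  obtain ⟨φ, hφ, rfl⟩ := h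
  exact ⟨φ, hφ.mono hβ, rfl⟩

theorem univ (hα : 1 ≤ α) : E.IsSigmaSet α (Set.univ : Set (FiberPower p n)) :=
  ⟨.top, .top hα, (Set.eq_univ_of_forall fun _ => trivial).symm⟩

theorem inter (hP : E.IsSigmaSet α P) (hQ : E.IsSigmaSet α Q) : E.IsSigmaSet α (P ∩ Q) := by
  obtain ⟨φ, hφ, rfl⟩ := hP
  obtain ⟨ψ, hψ, rfl⟩ := hQ
  exact ⟨.and φ ψ, .and hφ hψ, rfl⟩

theorem compl_of_lt (h : E.IsSigmaSet β P) (hβ : β < α) : E.IsSigmaSet α Pᶜ := by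
  obtain ⟨φ, hφ, rfl⟩ := h
  exact ⟨.neg φ, .neg_of_lt hβ hφ, rfl⟩

theorem biUnion (hα : 1 ≤ α) {ι : Type*} {s : Set ι} (hs : s.Countable)
    {A : ι → Set (FiberPower p n)} (h : ∀ i ∈ s, E.IsSigmaSet α (A i)) :
    E.IsSigmaSet α (⋃ i ∈ s, A i) := by
  choose φ hφ hA using fun i : s => h i.1 i.2
  have : Countable s := hs.to_subtype
  obtain ⟨ψ, hψ, hψ'⟩ := Formula.exists_iSup.{u, v, w} hα (Set.countable_range φ)
    (by rintro _ ⟨i, rfl⟩; exact hφ i)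
  refine ⟨ψ, hψ, ?_⟩
  ext q
  refine Iff.trans ?_ (hψ' _ (E.toTuple q)).symm
  simp only [Set.mem_iUnion]
  constructor
  · rintro ⟨i, hi, hq⟩
    rw [show A i = _ from hA ⟨i, hi⟩] at hq
    exact ⟨_, ⟨⟨i, hi⟩, rfl⟩, hq⟩
  · rintro ⟨_, ⟨i, rfl⟩, hq⟩
    refine ⟨i.1, i.2, ?_⟩
    rw [hA i]
    exact hq

theorem comap_preimage (h : E.IsSigmaSet α P) (f : Fin n → Fin m) :
    E.IsSigmaSet α (FiberPower.comap f ⁻¹' P) := by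
  obtain ⟨φ, hφ, rfl⟩ := h
  refine ⟨φ.rename f, hφ.rename f, ?_⟩
  ext q
  exact (Formula.realize_rename φ f (E.toTuple q)).symm

theorem comap_image {P : Set (FiberPower p m)} (h : E.IsSigmaSet α P) (f : Fin n → Fin m) :
    E.IsSigmaSet α (FiberPower.comap f '' P) := by
  obtain ⟨φ, hφ, rfl⟩ := h
  refine ⟨φ.image f, hφ.image f, ?_⟩
  ext q
  refine Iff.trans ?_ (Formula.realize_image f φ (E.toTuple q)).symm
  constructor
  · rintro ⟨r, hr, rfl⟩
    exact ⟨E.toTuple r, rfl, hr⟩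
  · rintro ⟨b, hb, h⟩
    refine ⟨E.toPower b, h, ?_⟩
    change E.toPower (b ∘ f) = q
    rw [hb]
    rfl

end IsSigmaSet

theorem HasSigmaOneSaturations.isSigmaSet (hE : E.HasSigmaOneSaturations) {α : Ordinal.{0}}
    (hα : 1 ≤ α) {n : ℕ} {V : Set (FiberPower p n)} (hV : IsOpen V) :
    E.IsSigmaSet α (E.saturation V) := by
  obtain ⟨φ, hφ, h⟩ := hE n V hV
  exact ⟨φ, hφ.mono hα, h⟩

variable (E)

/-- `F n V` consists of the tuples `a` such that nonmeagerly many of the isomorphisms sending `a`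
into `V` have their target in `A`. -/
structure IsVaughtTransform (β : Ordinal.{0}) (A : Set X)
    (F : ∀ n, Set (FiberPower p n) → Set (FiberPower p n)) : Prop where
  isSigmaSet (n : ℕ) (V : Set (FiberPower p n)) : IsOpen V → E.IsSigmaSet β (F n V)
  mono {n m : ℕ} (f : Fin n → Fin m) (V : Set (FiberPower p n)) (W : Set (FiberPower p m)) :
    (∀ r ∈ W, FiberPower.comap f r ∈ V) → ∀ (x : X) (c : Fin m → E.Fiber x),
      E.toPower c ∈ F m W → E.toPower (c ∘ f) ∈ F n V
  isComeager : E.IsComeager {x | x ∈ A ↔ ∀ (n : ℕ) (V : Set (FiberPower p n)), IsOpen V →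
    ∀ c : Fin n → E.Fiber x, E.toPower c ∈ V → E.toPower c ∈ F n V}

variable {E}

/-- Over an open A, "nonmeagerly many" amounts to "at least one", so the transform is a saturation.
The exceptional points form a nowhere dense set: `x ∈ A`, or a tuple in V outside the saturation, is
a certificate of agreement that persists nearby. -/
theorem exists_isVaughtTransform_of_isOpen (hE : E.HasSigmaOneSaturations) {A : Set X}
    (hA : IsOpen A) : ∃ F, E.IsVaughtTransform 1 A F := by
  have hV : ∀ n (V : Set (FiberPower p n)), IsOpen V → IsOpen (V ∩ FiberPower.base ⁻¹' A) :=
    fun n V hV => hV.inter (hA.preimage FiberPower.continuous_base)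
  refine ⟨fun n V => E.saturation (V ∩ FiberPower.base ⁻¹' A),
    fun n V h => hE.isSigmaSet le_rfl (hV n V h), ?_, ?_⟩
  · intro n m f V W h x c hc
    obtain ⟨y, g, hg, hg'⟩ := toPower_mem_saturation.1 hc
    exact toPower_mem_saturation.2 ⟨y, g, h _ hg, hg'⟩
  · refine IsDenseOpen.isComeager ⟨?_, ?_⟩
    · intro x hx
      by_cases hxA : x ∈ A
      · refine ⟨0, FiberPower.base ⁻¹' A, Set.univ (α := FiberPower p 0), hA.preimage FiberPower.continuous_base,
          fun _ _ _ _ _ => trivial, ⟨Fin.elim0, hxA, trivial⟩, fun y _ hy _ => ?_⟩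
        exact ⟨fun _ n V _ c hc => toPower_mem_saturation.2 ⟨y, .refl L _, hc, hy⟩, fun _ => hy⟩
      · have : ¬ ∀ (n : ℕ) (V : Set (FiberPower p n)), IsOpen V → ∀ c : Fin n → E.Fiber x,
          E.toPower c ∈ V → E.toPower c ∈ E.saturation (V ∩ FiberPower.base ⁻¹' A) :=
          fun h => hxA (hx.2 h)
        push Not at this
        obtain ⟨n, V, hV', c, hc, hcV⟩ := this
        refine ⟨n, V, _, hV', (hE.isSigmaSet le_rfl (hV n V hV')).invariant.compl,
          ⟨c, hc, hcV⟩, fun y c' hc' hcV' => ⟨fun hy => ?_, fun h => ?_⟩⟩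
        · exact (hcV' (toPower_mem_saturation.2 ⟨y, .refl L _, hc', hy⟩)).elim
        · exact absurd (h n V hV' c' hc') hcV'
    · intro x n V a hV' ha
      by_cases h : E.toPower a ∈ E.saturation (V ∩ FiberPower.base ⁻¹' A)
      · obtain ⟨y, g, hg, hy⟩ := toPower_mem_saturation.1 h
        exact ⟨y, ⟨fun _ n V _ c hc => toPower_mem_saturation.2 ⟨y, .refl L _, hc, hy⟩,
          fun _ => hy⟩, g, hg⟩
      · refine ⟨x, ⟨fun hx => ?_, fun h' => absurd (h' n V hV' a ha) h⟩, .refl L _, ha⟩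
        exact (h (toPower_mem_saturation.2 ⟨x, .refl L _, ha, hx⟩)).elim

/-- For A = ⋃ Oⱼ \ Cⱼ, nonmeagerly many isomorphisms sending c into V land in A exactly if some
c-extending tuple b and basic W, lying over V and Oⱼ, are such that b can be sent into W but almost
never with target in Cⱼ. This is a countable union of projections of a saturation minus a transform
of lower class, hence Σ_β. -/
theorem exists_isVaughtTransform [SecondCountableTopology X] [SecondCountableTopology M]
    (hE : E.HasSigmaOneSaturations) {β : Ordinal.{0}} {A : Set X} (hA : BorelSigma β A) :
    ∃ F, E.IsVaughtTransform β A F := by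
  induction β using WellFoundedLT.induction generalizing A with
  | ind β ih =>
  rcases BorelSigma.eq_one_or_two_le hA.one_le with rfl | h2
  · exact exists_isVaughtTransform_of_isOpen hE (hA.isOpen (by norm_num))
  obtain ⟨O, C, γ, hO, hγ, hC, rfl⟩ := hA.exists_eq_iUnion_isOpen h2
  choose G hG using fun j => ih (γ j) (hγ j) (hC j)
  let T : ℕ → Type _ := fun n => ℕ × Σ m, (Fin n → Fin m) × countableBasis (FiberPower p m)
  have hT : ∀ n, Countable (T n) := fun n => by
    have : ∀ m, Countable (countableBasis (FiberPower p m)) := fun m =>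
      (countable_countableBasis _).to_subtype
    infer_instance
  let F : ∀ n, Set (FiberPower p n) → Set (FiberPower p n) := fun n V =>
    ⋃ t ∈ {t : T n | ∀ r ∈ t.2.2.2.1, FiberPower.comap t.2.2.1 r ∈ V ∧ r.base ∈ O t.1},
      FiberPower.comap t.2.2.1 '' (E.saturation t.2.2.2.1 ∩ (G t.1 t.2.1 t.2.2.2.1)ᶜ)
  have hF : ∀ {n : ℕ} {V : Set (FiberPower p n)} {x : X} {c : Fin n → E.Fiber x},
      E.toPower c ∈ F n V ↔ ∃ (j m : ℕ) (f : Fin n → Fin m) (W : Set (FiberPower p m)),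
        W ∈ countableBasis (FiberPower p m) ∧
        (∀ r ∈ W, FiberPower.comap f r ∈ V ∧ r.base ∈ O j) ∧ ∃ b : Fin m → E.Fiber x,
          b ∘ f = c ∧ E.toPower b ∈ E.saturation W ∧ E.toPower b ∉ G j m W := by
    intro n V x c
    simp only [F, Set.mem_iUnion]
    constructor
    · rintro ⟨⟨j, m, f, W⟩, ht, r, ⟨hr, hr'⟩, h⟩
      obtain ⟨b, rfl, hb⟩ := exists_toPower_of_comap_eq h
      exact ⟨j, m, f, W.1, W.2, ht, b, hb, hr, hr'⟩
    · rintro ⟨j, m, f, W, hW, ht, b, rfl, hr, hr'⟩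
      exact ⟨⟨j, m, f, ⟨W, hW⟩⟩, ht, _, ⟨hr, hr'⟩, rfl⟩
  have hFS : ∀ n V, IsOpen V → E.IsSigmaSet β (F n V) := by
    intro n V _
    refine IsSigmaSet.biUnion hA.one_le (Set.to_countable _) fun t _ => ?_
    have ho := isOpen_of_mem_countableBasis t.2.2.2.2
    exact ((hE.isSigmaSet hA.one_le ho).inter
      (((hG t.1).isSigmaSet _ _ ho).compl_of_lt (hγ t.1))).comap_image _
  refine ⟨F, hFS, ?_, ?_⟩
  · intro n m f V W hVW x c hc
    obtain ⟨j, l, g, U, hU, hUW, b, rfl, hb, hb'⟩ := hF.1 hc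
    exact hF.2 ⟨j, l, g ∘ f, U, hU, fun r hr => ⟨hVW _ (hUW r hr).1, (hUW r hr).2⟩, b, rfl, hb, hb'⟩
  -- Where the transforms `G j` are correct, the first alternative certifies that x lies outside C j
  -- and inside O j; the second refutes the condition on F. Both persist nearby because the
  -- complements of the transforms are invariant.
  let Z : Set X := {x | (∃ (j m : ℕ) (W : Set (FiberPower p m)), IsOpen W ∧
      (∀ r ∈ W, r.base ∈ O j) ∧ ∃ b : Fin m → E.Fiber x, E.toPower b ∈ W ∧
        E.toPower b ∉ G j m W) ∨
    ∃ (n : ℕ) (V : Set (FiberPower p n)), IsOpen V ∧ ∃ c : Fin n → E.Fiber x,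
      E.toPower c ∈ V ∧ E.toPower c ∉ F n V}
  have hZ : E.IsDenseOpen Z := by
    refine ⟨?_, ?_⟩
    · rintro x (⟨j, m, W, hW, hWO, b, hb, hb'⟩ | ⟨n, V, hV, c, hc, hc'⟩)
      · exact ⟨m, W, (G j m W)ᶜ, hW, ((hG j).isSigmaSet _ _ hW).invariant.compl, ⟨b, hb, hb'⟩,
          fun y d hd hd' => Or.inl ⟨j, m, W, hW, hWO, d, hd, hd'⟩⟩
      · exact ⟨n, V, (F n V)ᶜ, hV, (hFS n V hV).invariant.compl, ⟨c, hc, hc'⟩,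
          fun y d hd hd' => Or.inr ⟨n, V, hV, d, hd, hd'⟩⟩
    · intro x n V a hV ha
      by_cases h : E.toPower a ∈ F n V
      · obtain ⟨j, m, f, W, hW, hWV, b, rfl, hb, hb'⟩ := hF.1 h
        obtain ⟨y, g, hg⟩ := toPower_mem_saturation.1 hb
        have hW' := isOpen_of_mem_countableBasis hW
        exact ⟨y, Or.inl ⟨j, m, W, hW', fun r hr => (hWV r hr).2, g ∘ b, hg,
          ((hG j).isSigmaSet _ _ hW').invariant.compl g b hb'⟩, g, (hWV _ hg).1⟩
      · exact ⟨x, Or.inr ⟨n, V, hV, a, ha, h⟩, .refl L _, ha⟩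
  refine ((IsComeager.iInter fun j => (hG j).isComeager).inter hZ.isComeager).mono ?_
  rintro x ⟨hx, hxZ⟩
  have hx : ∀ j, x ∈ C j ↔ _ := fun j => Set.mem_iInter.1 hx j
  constructor
  · intro hxA n V hV c hc
    obtain ⟨j, hxO, hxC⟩ := Set.mem_iUnion.1 hxA
    rw [hx] at hxC
    push Not at hxC
    obtain ⟨m, W, hW, b, hb, hb'⟩ := hxC
    have happ : (Fin.append c b ∘ Fin.castAdd m = c) ∧ (Fin.append c b ∘ Fin.natAdd n = b) :=
      ⟨funext fun i => Fin.append_left c b i, funext fun i => Fin.append_right c b i⟩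
    -- The joint tuple (c, b) links V, which concerns c, to the witness b for x ∉ C j. Monotonicity
    -- of `G j` keeps the witness valid on the smaller set U.
    obtain ⟨U, hU, hbU, hUV⟩ := (isBasis_countableBasis (FiberPower p (n + m))).exists_subset_of_mem_open
      (show E.toPower (Fin.append c b) ∈ FiberPower.comap (Fin.castAdd m) ⁻¹' V ∩
        FiberPower.comap (Fin.natAdd n) ⁻¹' W ∩ FiberPower.base ⁻¹' O j from by
        refine ⟨⟨?_, ?_⟩, hxO⟩
        · change E.toPower (Fin.append c b ∘ Fin.castAdd m) ∈ V
          rwa [happ.1]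
        · change E.toPower (Fin.append c b ∘ Fin.natAdd n) ∈ W
          rwa [happ.2])
      (((hV.preimage (FiberPower.continuous_comap _)).inter
        (hW.preimage (FiberPower.continuous_comap _))).inter
        ((hO j).preimage FiberPower.continuous_base))
    refine hF.2 ⟨j, n + m, Fin.castAdd m, U, hU, fun r hr => ⟨(hUV hr).1.1, (hUV hr).2⟩,
      Fin.append c b, happ.1, toPower_mem_saturation.2 ⟨x, .refl L _, hbU⟩, fun h => hb' ?_⟩
    have := (hG j).mono (Fin.natAdd n) W U (fun r hr => (hUV hr).1.2) x _ h
    rwa [happ.2] at this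
  · intro h
    rcases hxZ with ⟨j, m, W, hW, hWO, b, hb, hb'⟩ | ⟨n, V, hV, c, hc, hc'⟩
    · refine Set.mem_iUnion.2 ⟨j, hWO _ hb, fun hxC => hb' ?_⟩
      exact (hx j).1 hxC m W hW b hb
    · exact absurd (h n V hV c hc) hc'

/-- Invariant `Π⁰_{α+1}` sets are defined by countably many implications between `Σ_α`
formulas. -/
theorem exists_isSigmaSet_of_borelPi [QuasiPolishSpace X] [SecondCountableTopology M]
    [Countable L.Symbols] (hE : E.HasSigmaOneSaturations) {α : Ordinal.{0}} (hα : 1 ≤ α)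
    {Y : Set X} (hY : ∀ x y, Nonempty (E.Fiber x ≃[L] E.Fiber y) → x ∈ Y → y ∈ Y)
    (h : BorelPi (α + 1) Y) :
    ∃ 𝒢 : Set (Σ n, Set (FiberPower p n) × Set (FiberPower p n)), 𝒢.Countable ∧
      (∀ t ∈ 𝒢, E.IsSigmaSet α t.2.1 ∧ E.IsSigmaSet α t.2.2) ∧
      ∀ y, y ∈ Y ↔ ∀ t ∈ 𝒢, ∀ a : Fin t.1 → E.Fiber y, E.toPower a ∈ t.2.1 →
        E.toPower a ∈ t.2.2 := by
  have : SecondCountableTopology X := QuasiPolishSpace.secondCountableTopology X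
  obtain ⟨O, C, γ, hO, hγ, hC, hY'⟩ := BorelSigma.exists_eq_iUnion_isOpen h
    (BorelSigma.two_le_of_lt hα (Order.lt_add_one_iff.2 le_rfl))
  choose F hF using fun i => exists_isVaughtTransform hE (hC i)
  have hco := IsComeager.iInter fun i => (hF i).isComeager
  have hmem : ∀ {z}, z ∈ Y → ∀ i, z ∈ O i → z ∈ C i := by
    intro z hz i hzO
    by_contra hzC
    have : z ∈ Yᶜ := hY' ▸ Set.mem_iUnion.2 ⟨i, hzO, hzC⟩
    exact this hz
  -- Y consists of the points for which O i implies C i. For V over O i, the implication says that a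
  -- tuple which can be sent into V at all is sent there nonmeagerly often with target in C i.
  let 𝒢 : Set (Σ n, Set (FiberPower p n) × Set (FiberPower p n)) := ⋃ (i : ℕ) (n : ℕ),
    (fun V => ⟨n, E.saturation V, F i n V⟩) ''
      {V | V ∈ countableBasis (FiberPower p n) ∧ V ⊆ FiberPower.base ⁻¹' O i}
  refine ⟨𝒢, Set.countable_iUnion fun i => Set.countable_iUnion fun n =>
    ((countable_countableBasis _).mono fun V hV => hV.1).image _, ?_, fun y => ⟨?_, ?_⟩⟩
  · intro t ht
    simp only [𝒢, Set.mem_iUnion] at ht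
    obtain ⟨i, n, V, ⟨hV, hVO⟩, rfl⟩ := ht
    have ho := isOpen_of_mem_countableBasis hV
    exact ⟨hE.isSigmaSet hα ho, ((hF i).isSigmaSet n V ho).mono (Order.lt_add_one_iff.1 (hγ i))⟩
  · intro hy t ht a ha
    simp only [𝒢, Set.mem_iUnion] at ht
    obtain ⟨i, n, V, ⟨hV, hVO⟩, rfl⟩ := ht
    have ho := isOpen_of_mem_countableBasis hV
    obtain ⟨z, g, hg⟩ := toPower_mem_saturation.1 ha
    obtain ⟨z', hz', g', hg'⟩ := hco.exists_mem ho hg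
    have hzC := hmem (hY y z' ⟨g'.comp g⟩ hy) i (hVO hg')
    have h1 := (Set.mem_iInter.1 hz' i).1 hzC n V ho _ hg'
    have h2 := ((hF i).isSigmaSet n V ho).invariant (g'.comp g).symm _ h1
    rwa [show (g'.comp g).symm ∘ g' ∘ g ∘ a = a from
      funext fun k => (g'.comp g).symm_apply_apply (a k)] at h2
  · intro hy
    -- By invariance y may be replaced by an isomorphic z at which all transforms are correct; a
    -- failure of z to lie in C i then shows up in some basic U over O i and violates an
    -- implication.
    obtain ⟨z, hz, g, -⟩ := hco.exists_mem (n := 0) (a := (Fin.elim0 : Fin 0 → E.Fiber y))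
      isOpen_univ (Set.mem_univ _)
    refine hY z y ⟨g.symm⟩ ?_
    by_contra hzY
    have : z ∈ Yᶜ := hzY
    rw [hY'] at this
    obtain ⟨i, hzO, hzC⟩ := Set.mem_iUnion.1 this
    have hzF := mt (Set.mem_iInter.1 hz i).2 hzC
    push Not at hzF
    obtain ⟨n, V, hV, c, hc, hc'⟩ := hzF
    obtain ⟨U, hU, hcU, hUV⟩ := (isBasis_countableBasis (FiberPower p n)).exists_subset_of_mem_open
      (show E.toPower c ∈ V ∩ FiberPower.base ⁻¹' O i from ⟨hc, hzO⟩)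
      (hV.inter ((hO i).preimage FiberPower.continuous_base))
    have hinv := ((hF i).isSigmaSet n U (isOpen_of_mem_countableBasis hU)).invariant
    have h1 := hy ⟨n, E.saturation U, F i n U⟩ (Set.mem_iUnion.2 ⟨i, Set.mem_iUnion.2
      ⟨n, U, ⟨hU, hUV.trans Set.inter_subset_right⟩, rfl⟩⟩) (g.symm ∘ c)
      (toPower_mem_saturation.2 ⟨z, g, by
        rwa [show g ∘ g.symm ∘ c = c from funext fun k => g.apply_symm_apply (c k)]⟩)
    have h2 := hinv g _ h1
    rw [show g ∘ g.symm ∘ c = c from funext fun k => g.apply_symm_apply (c k)] at h2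
    exact hc' ((hF i).mono id V U (fun r hr => (hUV hr).1) z c h2)

end EtaleStructure

/-! ### Finding a generic point of the orbit -/

namespace EtaleStructure

variable {X : Type z} [TopologicalSpace X] {M : Type w} [TopologicalSpace M]
  {L : FirstOrder.Language.{u, v}} {p : M → X} (E : EtaleStructure L p)

/-- Open sets of the topology on `X` generated by the projections of the intersections of open
sets and sets defined by `Σ_α` formulas. -/
def sigmaOpens (α : Ordinal.{0}) : Set (Set X) :=
  {S | ∀ x ∈ S, ∃ (n : ℕ) (V P : Set (FiberPower p n)), IsOpen V ∧ E.IsSigmaSet α P ∧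
    (∃ c : Fin n → E.Fiber x, E.toPower c ∈ V ∧ E.toPower c ∈ P) ∧
    ∀ (y : X) (c : Fin n → E.Fiber y), E.toPower c ∈ V → E.toPower c ∈ P → y ∈ S}

variable {E} {α : Ordinal.{0}}

theorem mem_base_image {n : ℕ} {V : Set (FiberPower p n)} {x : X} :
    x ∈ FiberPower.base '' V ↔ ∃ c : Fin n → E.Fiber x, E.toPower c ∈ V := by
  constructor
  · rintro ⟨q, hq, rfl⟩
    exact ⟨E.toTuple q, hq⟩
  · rintro ⟨c, hc⟩
    exact ⟨_, hc, rfl⟩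

theorem base_image_mem_sigmaOpens {n : ℕ} {V P : Set (FiberPower p n)} (hV : IsOpen V)
    (hP : E.IsSigmaSet α P) : FiberPower.base '' (V ∩ P) ∈ E.sigmaOpens α := by
  intro x hx
  exact ⟨n, V, P, hV, hP, mem_base_image.1 hx, fun y c hc hc' => ⟨_, ⟨hc, hc'⟩, rfl⟩⟩

theorem isOpen_mem_sigmaOpens (hα : 1 ≤ α) {U : Set X} (hU : IsOpen U) : U ∈ E.sigmaOpens α :=
  fun _ hx => ⟨0, FiberPower.base ⁻¹' U, Set.univ, hU.preimage FiberPower.continuous_base,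
    .univ hα, ⟨Fin.elim0, hx, trivial⟩, fun _ _ hy _ => hy⟩

theorem inter_mem_sigmaOpens {A B : Set X} (hA : A ∈ E.sigmaOpens α) (hB : B ∈ E.sigmaOpens α) :
    A ∩ B ∈ E.sigmaOpens α := by
  rintro x ⟨hxA, hxB⟩
  obtain ⟨n, V, P, hV, hP, ⟨c, hc, hc'⟩, h⟩ := hA x hxA
  obtain ⟨m, W, Q, hW, hQ, ⟨d, hd, hd'⟩, h'⟩ := hB x hxB
  refine ⟨n + m, FiberPower.comap (Fin.castAdd m) ⁻¹' V ∩ FiberPower.comap (Fin.natAdd n) ⁻¹' W,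
    FiberPower.comap (Fin.castAdd m) ⁻¹' P ∩ FiberPower.comap (Fin.natAdd n) ⁻¹' Q,
    (hV.preimage (FiberPower.continuous_comap _)).inter
      (hW.preimage (FiberPower.continuous_comap _)),
    (hP.comap_preimage _).inter (hQ.comap_preimage _), ⟨Fin.append c d, ?_⟩,
    fun y e he he' => ⟨h y _ he.1 he'.1, h' y _ he.2 he'.2⟩⟩
  have h1 : FiberPower.comap (Fin.castAdd m) (E.toPower (Fin.append c d)) = E.toPower c :=
    congrArg E.toPower (funext fun i => Fin.append_left c d i)
  have h2 : FiberPower.comap (Fin.natAdd n) (E.toPower (Fin.append c d)) = E.toPower d :=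
    congrArg E.toPower (funext fun i => Fin.append_right c d i)
  simp only [Set.mem_inter_iff, Set.mem_preimage, h1, h2]
  exact ⟨⟨hc, hd⟩, hc', hd'⟩

/-- Truth equals forcing, by induction on formulas. Restricting to sheets makes the tuple over a
point unique, so that projection commutes with conjunction and turns negation into a difference. -/
theorem decided_base_image [SecondCountableTopology X] [SecondCountableTopology M]
    {e : X → ℕ → Prop} (he : IsEmbedding e) {K : Set X} (hα : 1 ≤ α)
    {n : ℕ} {P V : Set (FiberPower p n)} (hP : E.IsSigmaSet α P) (hV : IsOpen V) :
    Decided e (E.sigmaOpens α) K (FiberPower.base '' (V ∩ P)) := by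
  have hopen : ∀ {n : ℕ} {V : Set (FiberPower p n)}, IsOpen V →
      Decided e (E.sigmaOpens α) K (FiberPower.base '' V) := fun h =>
    Decided.of_isOpen he (fun U hU => isOpen_mem_sigmaOpens hα hU)
      (FiberPower.isOpenMap_base E.isLocalHomeomorph _ _ h)
  have hsheets : ∀ {n : ℕ}, Countable (sheets (FiberPower.base : FiberPower p n → X)) :=
    (countable_sheets _).to_subtype
  have key : ∀ {β : Ordinal.{0}} {n : ℕ} {φ : Formula L n}, φ.IsSigma β → β ≤ α →
      ∀ {V : Set (FiberPower p n)}, IsOpen V →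
        Decided e (E.sigmaOpens α) K (FiberPower.base '' (V ∩ E.interp φ)) := by
    intro β n φ h
    induction h with
    | rel _ R ts => exact fun _ V hV => hopen (hV.inter (E.isOpen_interp_atomic (.rel R ts)))
    | equal _ s t => exact fun _ V hV => hopen (hV.inter (E.isOpen_interp_atomic (.equal s t)))
    | top _ => exact fun _ V hV => hopen (hV.inter isOpen_univ)
    | bot _ => exact fun _ V hV => hopen (hV.inter isOpen_empty)
    | @and β n φ ψ hφ hψ ihφ ihψ =>
      intro hβ V hV
      have : FiberPower.base '' (V ∩ E.interp (.and φ ψ)) =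
          ⋃ W : sheets (FiberPower.base : FiberPower p n → X),
            FiberPower.base '' (V ∩ W.1 ∩ E.interp φ) ∩
              FiberPower.base '' (V ∩ W.1 ∩ E.interp ψ) := by
        ext x
        simp only [Set.mem_iUnion]
        constructor
        · rintro ⟨q, ⟨hq, hq1, hq2⟩, rfl⟩
          obtain ⟨W, hW, hqW, _⟩ := exists_mem_sheets (E.isLocallyInjective_base n) isOpen_univ
            (Set.mem_univ q)
          exact ⟨⟨W, hW⟩, ⟨q, ⟨⟨hq, hqW⟩, hq1⟩, rfl⟩, ⟨q, ⟨⟨hq, hqW⟩, hq2⟩, rfl⟩⟩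
        · rintro ⟨W, ⟨q, ⟨⟨hq, hqW⟩, hq1⟩, rfl⟩, ⟨r, ⟨⟨hr, hrW⟩, hr1⟩, h⟩⟩
          obtain rfl := W.2.2 hrW hqW h
          exact ⟨_, ⟨hq, hq1, hr1⟩, rfl⟩
      rw [this]
      have ho := fun W : sheets (FiberPower.base : FiberPower p n → X) =>
        hV.inter (isOpen_of_mem_sheets W.2)
      exact Decided.iUnion (fun W => (ihφ hβ (ho W)).inter (ihψ hβ (ho W))) fun W =>
        inter_mem_sigmaOpens (base_image_mem_sigmaOpens (ho W) ⟨φ, hφ.mono hβ, rfl⟩)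
          (base_image_mem_sigmaOpens (ho W) ⟨ψ, hψ.mono hβ, rfl⟩)
    | @iSup β n φ hφ ih =>
      intro hβ V hV
      have : FiberPower.base '' (V ∩ E.interp (.iSup φ)) =
          ⋃ i, FiberPower.base '' (V ∩ E.interp (φ i)) := by
        rw [← Set.image_iUnion, ← Set.inter_iUnion]
        congr 2
        ext q
        simp [interp, Formula.Realize]
      rw [this]
      exact Decided.iUnion (fun i => ih i hβ hV) fun i =>
        base_image_mem_sigmaOpens hV ⟨φ i, (hφ i).mono hβ, rfl⟩
    | @ex β n φ hφ ih =>
      intro hβ V hV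
      have : FiberPower.base '' (V ∩ E.interp (.ex φ)) =
          FiberPower.base '' (FiberPower.comap Fin.castSucc ⁻¹' V ∩ E.interp φ) := by
        rw [E.interp_ex, Set.inter_comm, ← Set.image_inter_preimage, Set.image_image, Set.inter_comm]
        rfl
      rw [this]
      exact ih hβ (hV.preimage (FiberPower.continuous_comap _))
    | of_lt h _ ih => exact fun hβ => ih (h.le.trans hβ)
    | @neg_of_lt γ β n φ h hφ ih =>
      intro hβ V hV
      have hW : ∀ W : sheets (FiberPower.base : FiberPower p n → X),
          FiberPower.base '' (V ∩ W.1) \ FiberPower.base '' (V ∩ W.1 ∩ E.interp φ) =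
            FiberPower.base '' (V ∩ W.1 ∩ E.interp (.neg φ)) := by
        intro W
        ext x
        constructor
        · rintro ⟨⟨q, hq, rfl⟩, hx⟩
          exact ⟨q, ⟨hq, fun hqφ => hx ⟨q, ⟨hq, hqφ⟩, rfl⟩⟩, rfl⟩
        · rintro ⟨q, ⟨hq, hqφ⟩, rfl⟩
          refine ⟨⟨q, hq, rfl⟩, ?_⟩
          rintro ⟨r, ⟨hr, hrφ⟩, h⟩
          obtain rfl := W.2.2 hr.2 hq.2 h
          exact hqφ hrφ
      have : FiberPower.base '' (V ∩ E.interp (.neg φ)) =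
          ⋃ W : sheets (FiberPower.base : FiberPower p n → X),
            FiberPower.base '' (V ∩ W.1) \ FiberPower.base '' (V ∩ W.1 ∩ E.interp φ) := by
        simp only [hW]
        ext x
        simp only [Set.mem_iUnion]
        constructor
        · rintro ⟨q, ⟨hq, hqφ⟩, rfl⟩
          obtain ⟨W, hW, hqW, _⟩ := exists_mem_sheets (E.isLocallyInjective_base n) isOpen_univ
            (Set.mem_univ q)
          exact ⟨⟨W, hW⟩, q, ⟨⟨hq, hqW⟩, hqφ⟩, rfl⟩
        · rintro ⟨W, q, ⟨hq, hqφ⟩, rfl⟩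
          exact ⟨q, ⟨hq.1, hqφ⟩, rfl⟩
      rw [this]
      have ho := fun W : sheets (FiberPower.base : FiberPower p n → X) =>
        hV.inter (isOpen_of_mem_sheets W.2)
      have hmem : ∀ W : sheets (FiberPower.base : FiberPower p n → X),
          FiberPower.base '' (V ∩ W.1) \ FiberPower.base '' (V ∩ W.1 ∩ E.interp φ) ∈
            E.sigmaOpens α := fun W => by
        rw [hW]
        exact base_image_mem_sigmaOpens (ho W)
          ⟨_, Formula.IsSigma.mono (.neg_of_lt h hφ) hβ, rfl⟩
      exact Decided.iUnion (fun W => (hopen (ho W)).sdiff (ih (h.le.trans hβ) (ho W))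
        (base_image_mem_sigmaOpens (ho W) ⟨φ, hφ.mono (h.le.trans hβ), rfl⟩) (hmem W)) hmem
  obtain ⟨φ, hφ, rfl⟩ := hP
  exact key hφ le_rfl hV

/-- An omitting types argument with conditions from `E.sigmaOpens α` that meet the orbit of x. -/
theorem exists_isSigma_of_borelPi_orbit [QuasiPolishSpace X] [SecondCountableTopology M]
    [Countable L.Symbols] (hE : E.HasSigmaOneSaturations) (hα : 1 ≤ α) {x : X}
    (h : BorelPi (α + 1) (E.orbit x)) {n : ℕ} {ψ : Formula L n} (hψ : ψ.IsPi α)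
    (hx : ∃ a : Fin n → E.Fiber x, ψ.Realize a) :
    ∃ θ : Formula L n, θ.IsSigma α ∧ (∃ a : Fin n → E.Fiber x, θ.Realize a) ∧
      ∀ a : Fin n → E.Fiber x, θ.Realize a → ψ.Realize a := by
  have : SecondCountableTopology X := QuasiPolishSpace.secondCountableTopology X
  by_contra hcon
  obtain ⟨σ, hσ, rfl⟩ := hψ
  have hσS : E.IsSigmaSet α (E.interp σ) := ⟨σ, hσ, rfl⟩
  have hY : ∀ y z, Nonempty (E.Fiber y ≃[L] E.Fiber z) → y ∈ E.orbit x → z ∈ E.orbit x := by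
    rintro y z ⟨g⟩ ⟨f⟩
    exact ⟨g.comp f⟩
  obtain ⟨𝒢, hc, h𝒢, hmem⟩ := exists_isSigmaSet_of_borelPi hE hα hY h
  obtain ⟨e, he, hr⟩ := QuasiPolishSpace.exists_isEmbedding X
  have hc' : Countable 𝒢 := hc.to_subtype
  have hs : ∀ m, Countable (sheets (FiberPower.base : FiberPower p m → X)) := fun m =>
    (countable_sheets _).to_subtype
  -- The first summand makes the generic point satisfy the implications defining the orbit, the
  -- second makes every tuple over it satisfy σ.
  let ι := (Σ t : 𝒢, sheets (FiberPower.base : FiberPower p t.1.1 → X)) ⊕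
    sheets (FiberPower.base : FiberPower p n → X)
  let A : ι → Set X := Sum.elim (fun t => FiberPower.base '' (t.2.1 ∩ t.1.1.2.1))
    fun W => FiberPower.base '' (W.1 ∩ Set.univ)
  let B : ι → Set X := Sum.elim (fun t => FiberPower.base '' (t.2.1 ∩ t.1.1.2.2))
    fun W => FiberPower.base '' (W.1 ∩ E.interp σ)
  obtain ⟨z, -, hz⟩ := exists_generic_point he hr (𝒮 := E.sigmaOpens α)
    (fun U hU => isOpen_mem_sigmaOpens hα hU) (fun A hA B hB => inter_mem_sigmaOpens hA hB)
    (K := E.orbit x) (A := A) (B := B)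
    (by
      rintro (t | W)
      · exact decided_base_image he hα (h𝒢 _ t.1.2).1 (isOpen_of_mem_sheets t.2.2)
      · exact decided_base_image he hα (.univ hα) (isOpen_of_mem_sheets W.2))
    (by
      rintro (t | W)
      · exact decided_base_image he hα (h𝒢 _ t.1.2).2 (isOpen_of_mem_sheets t.2.2)
      · exact decided_base_image he hα hσS (isOpen_of_mem_sheets W.2))
    (by
      rintro (t | W)
      · exact base_image_mem_sigmaOpens (isOpen_of_mem_sheets t.2.2) (h𝒢 _ t.1.2).2
      · exact base_image_mem_sigmaOpens (isOpen_of_mem_sheets W.2) hσS)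
    (by
      rintro (t | W) S hS hSA ⟨y, hyS, hy⟩
      · obtain ⟨a, haW, ha⟩ := (mem_base_image (E := E)).1 (hSA hyS)
        exact ⟨y, ⟨hyS, _, ⟨haW, (hmem y).1 hy _ t.1.2 a ha⟩, rfl⟩, hy⟩
      · obtain ⟨c, hcW, -⟩ := (mem_base_image (E := E)).1 (hSA hyS)
        obtain ⟨m, V, P, hV, hP, ⟨b, hb, hb'⟩, hVP⟩ := hS y hyS
        let U : Set (FiberPower p (m + n)) :=
          FiberPower.comap (Fin.castAdd n) ⁻¹' V ∩ FiberPower.comap (Fin.natAdd m) ⁻¹' W.1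
        have hU : IsOpen U := (hV.preimage (FiberPower.continuous_comap _)).inter
          ((isOpen_of_mem_sheets W.2).preimage (FiberPower.continuous_comap _))
        -- What the condition S and the sheet W say about c up to isomorphism: some b satisfies P
        -- and (b, c) can be sent into V × W. This is Σ_α and nonempty over x, so by assumption it
        -- does not imply ¬σ.
        have hΘ : E.IsSigmaSet α (FiberPower.comap (Fin.natAdd m) ''
            (E.saturation U ∩ FiberPower.comap (Fin.castAdd n) ⁻¹' P)) :=
          ((hE.isSigmaSet hα hU).inter (hP.comap_preimage _)).comap_image _
        have h1 : FiberPower.comap (Fin.castAdd n) (E.toPower (Fin.append b c)) = E.toPower b :=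
          congrArg E.toPower (funext fun i => Fin.append_left b c i)
        have h2 : FiberPower.comap (Fin.natAdd m) (E.toPower (Fin.append b c)) = E.toPower c :=
          congrArg E.toPower (funext fun i => Fin.append_right b c i)
        have hcΘ : E.toPower c ∈ FiberPower.comap (Fin.natAdd m) ''
            (E.saturation U ∩ FiberPower.comap (Fin.castAdd n) ⁻¹' P) := by
          refine ⟨E.toPower (Fin.append b c), ⟨toPower_mem_saturation.2 ⟨y, .refl L _, ?_⟩, ?_⟩, h2⟩
          · change FiberPower.comap (Fin.castAdd n) (E.toPower (Fin.append b c)) ∈ V ∧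
              FiberPower.comap (Fin.natAdd m) (E.toPower (Fin.append b c)) ∈ W.1
            rw [h1, h2]
            exact ⟨hb, hcW⟩
          · rwa [Set.mem_preimage, h1]
        obtain ⟨f⟩ := hy
        have hinv := hΘ.invariant f.symm c hcΘ
        obtain ⟨θ, hθ, hΘθ⟩ := hΘ
        rw [hΘθ, toPower_mem_interp] at hinv
        have : ∃ a : Fin n → E.Fiber x, θ.Realize a ∧ σ.Realize a := by
          by_contra hne
          exact hcon ⟨θ, hθ, ⟨_, hinv⟩, fun a ha ha' => hne ⟨a, ha, ha'⟩⟩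
        obtain ⟨a, ha, haσ⟩ := this
        rw [← E.toPower_mem_interp, ← hΘθ] at ha
        obtain ⟨r, ⟨hrU, hrP⟩, hr⟩ := ha
        obtain ⟨d, rfl, rfl⟩ := exists_toPower_of_comap_eq hr
        -- A realization of σ inside this set is carried by an isomorphism to a point of the orbit
        -- that still lies in S.
        obtain ⟨z, g, hgV, hgW⟩ := toPower_mem_saturation.1 hrU
        refine ⟨z, ⟨hVP z _ hgV (hP.invariant g (d ∘ Fin.castAdd n) hrP), _,
          ⟨hgW, E.invariant_interp σ g _ haσ⟩, rfl⟩, ⟨g⟩⟩)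
    (S₀ := Set.univ) (isOpen_mem_sigmaOpens hα isOpen_univ)
    (Decided.of_isOpen he (fun U hU => isOpen_mem_sigmaOpens hα hU) isOpen_univ)
    ⟨x, trivial, ⟨.refl L _⟩⟩
  have hsheet : ∀ {m : ℕ} {Q : Set (FiberPower p m)} (W : sheets (FiberPower.base :
      FiberPower p m → X)) {a : Fin m → E.Fiber z}, E.toPower a ∈ W.1 →
      z ∈ FiberPower.base '' (W.1 ∩ Q) → E.toPower a ∈ Q := by
    rintro m Q W a ha ⟨r, ⟨hrW, hrQ⟩, hr⟩
    rwa [← W.2.2 hrW ha hr]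
  have hzY : z ∈ E.orbit x := by
    refine (hmem z).2 fun t ht a ha => ?_
    obtain ⟨W, hW, haW, -⟩ := exists_mem_sheets (E.isLocallyInjective_base t.1) isOpen_univ
      (Set.mem_univ (E.toPower a))
    exact hsheet ⟨W, hW⟩ haW (hz (Sum.inl ⟨⟨t, ht⟩, ⟨W, hW⟩⟩) ⟨_, ⟨haW, ha⟩, rfl⟩)
  obtain ⟨g⟩ := hzY
  obtain ⟨a, ha⟩ := hx
  obtain ⟨W, hW, haW, -⟩ := exists_mem_sheets (E.isLocallyInjective_base n) isOpen_univ
    (Set.mem_univ (E.toPower (g ∘ a)))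
  have := hsheet ⟨W, hW⟩ haW (hz (Sum.inr ⟨W, hW⟩) ⟨_, ⟨haW, trivial⟩, rfl⟩)
  exact ha ((Formula.realize_equiv g σ a).1 this)

end EtaleStructure

end ScottRank

/-! ### The cycle of implications -/

open ScottRank in
theorem mainTheorem11 {L : FirstOrder.Language.{u, v}} [Countable L.Symbols]
    {X : Type z} [TopologicalSpace X] [QuasiPolishSpace X]
    {M : Type w} [TopologicalSpace M] [SecondCountableTopology M] {p : M → X}
    (E : EtaleStructure L p) (hE : E.HasSigmaOneSaturations) (x : X)
    (α : Ordinal.{0}) (hα : 1 ≤ α) (hα' : α < Ordinal.omega 1) :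
    List.TFAE [
      ∀ (n : ℕ) (a : Fin n → E.Fiber x), ∃ φ : Formula L n, φ.IsSigma α ∧
        ∀ b : Fin n → E.Fiber x,
          φ.Realize b ↔ ∃ g : E.Fiber x ≃[L] E.Fiber x, ∀ i, g (a i) = b i,
      ∃ φ : Formula L 0, φ.IsPi (α + 1) ∧ φ.IsScottSentence (E.Fiber x),
      BorelPi (α + 1) (E.orbit x),
      ∀ (n : ℕ) (ψ : Formula L n), ψ.IsPi α → (∃ a : Fin n → E.Fiber x, ψ.Realize a) →
        ∃ θ : Formula L n, θ.IsSigma α ∧ (∃ a : Fin n → E.Fiber x, θ.Realize a) ∧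
          ∀ a : Fin n → E.Fiber x, θ.Realize a → ψ.Realize a] := by
  have hc : Countable (E.Fiber x) := E.countable_fiber x
  have : SecondCountableTopology X := QuasiPolishSpace.secondCountableTopology X
  tfae_have 1 → 2 := exists_scottSentence hα
  tfae_have 2 → 3 := fun ⟨_, hφ, hφ'⟩ => E.borelPi_orbit hφ hφ'
  tfae_have 3 → 4 := fun h _ _ hψ => EtaleStructure.exists_isSigma_of_borelPi_orbit hE hα h hψ
  tfae_have 4 → 1 := exists_isSigma_orbit hα
  tfae_finish
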